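/- Let $G$ be a finitely generated group and let $H_1,\dots,H_k$ be finitely many finitely generated subgroups of $G$ (in particular, for $k=1$, a single finitely generated subgroup $H$). If $G$ is hyperbolic relative to $H_1,\dots,H_k$ in the sense of Gromov, then $G$ is hyperbolic relative to $H_1,\dots,H_k$ in the sense of Farb. The two notions are the following. **Gromov's sense.** There is a complete, locally compact, geodesic, Gromov-hyperbolic metric space $X$ with a free, properly discontinuous, isometric action of $G$ such that: (a) the quotient $Y=X/G$, with the quotient metric, is quasi-isometric to the union of $k$ copies of $[0,\infty)$ joined at zero, and the $k$ rays lift to geodesic rays $\gamma_i\colon[0,\infty)\to X$ (that is, under the quasi-isometry, the image of $\gamma_i$ in $Y$ goes to infinity along the $i$-th copy of $[0,\infty)$); (b) $H_i$ is the isotropy subgroup of the point at infinity $\gamma_i(\infty)$, and $H_i$ preserves the horofunction $h_i(x)=\lim_{t\to\infty}(d(x,\gamma_i(t))-t)$; (c) there is a $G$-invariant system of pairwise disjoint horoballs (sets $\{x : h(x)<r\}$, where $h$ is the horofunction of a geodesic ray and $r\in\mathbb R$) such that $G$ acts cocompactly on the complement of their union. **Farb's sense.** For every finite generating set $A$ of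 $G$, let $\Gamma$ be the Cayley graph of $G$ with respect to $A$, and let $\hat\Gamma$ be the coned-off graph, obtained from $\Gamma$ by adding, for each $i$ and each left coset $gH_i$, a vertex $v(gH_i)$ joined to each element of $gH_i$ by an edge of length $\frac12$. Then (1) $\hat\Gamma$ is a hyperbolic metric space, and (2) the Bounded Coset Penetration property holds, as follows. The projection $\hat u$ to $\hat\Gamma$ of a path $u$ in $\Gamma$ is obtained by replacing, from left to right, each maximal nonconstant subpath of $u$ inside a coset $gH_i$ by the path of length $1$ through $v(gH_i)$ with the same endpoints (an edge whose label lies in several of the $H_i$ may be attributed to any of them); $u$ *penetrates* $gH_i$ if $\hat u$ passes through $v(gH_i)$, and the vertices of $\hat u$ just before and just after $v(gH_i)$ are those at which $u$ enters and exits $gH_i$. The path $u$ is *without backtracking* if $\hat u$ passes at most once through each cone vertex, and it is a *relative $P$-quasigeodesic* if each subpath of $\hat u$ has length at most $P$ times the $\hat\Gamma$-distance between its endpoints, plus $P$. For every $P\ge1$ there is a constant $c=c(P)$ such that, for any two relative $P$-quasigeodesics $u,v$ without backtracking with the same endpoints: if $u$ penetrates a coset $gH_i$ and $v$ does not, then the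 $\Gamma$-distance between the vertices at which $u$ enters and exits $gH_i$ is at most $c$; and if both penetrate $gH_i$, then the vertices at which $u$ and $v$ enter $gH_i$ are at $\Gamma$-distance at most $c$ from each other, and so are the vertices at which they exit $gH_i$. -/

import Mathlib

open Filter Topology
open scoped NNReal

namespace RelHyp

/-! ### Coarse metric notions -/

/-- Gromov hyperbolicity of a space with distance function `d`, by the four-point condition. -/
def GromovHyperbolic {V : Type*} (d : V → V → ℝ) : Prop :=
  ∃ δ : ℝ, 0 ≤ δ ∧ ∀ x y z w : V,
    d x y + d z w ≤ max (d x z + d y w) (d x w + d y z) + 2 * δ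

/-- Any two points are joined by a geodesic segment. -/
def IsGeodesicSpace (X : Type*) [MetricSpace X] : Prop :=
  ∀ x y : X, ∃ c : ℝ → X, c 0 = x ∧ c (dist x y) = y ∧
    ∀ s ∈ Set.Icc 0 (dist x y), ∀ t ∈ Set.Icc 0 (dist x y), dist (c s) (c t) = |s - t|

/-- `f` is a quasi-isometry from `V` to `W`, with respect to the given distance functions. -/
def IsQuasiIsometry {V W : Type*} (dV : V → V → ℝ) (dW : W → W → ℝ) (f : V → W) : Prop :=
  ∃ L C : ℝ, 1 ≤ L ∧ 0 ≤ C ∧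
    (∀ p q, L⁻¹ * dV p q - C ≤ dW (f p) (f q) ∧ dW (f p) (f q) ≤ L * dV p q + C) ∧
    ∀ w, ∃ p, dW (f p) w ≤ C

/-- The union of `k` copies of `[0,∞)` joined at zero: a point is given by its `k` coordinates,
at most one of which is nonzero. -/
def RayWedge (k : ℕ) : Type :=
  {a : Fin k → ℝ // (∀ i, 0 ≤ a i) ∧ ∀ i j, a i ≠ 0 → a j ≠ 0 → i = j}

/-- The path metric of the union of `k` rays joined at zero. -/
noncomputable def RayWedge.distance {k : ℕ} (a b : RayWedge k) : ℝ :=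
  ∑ i, |a.1 i - b.1 i|

/-- The quotient distance on `X/G`: the infimum of the distances between points of two orbits. -/
noncomputable def quotDist {G X : Type*} [Group G] [MetricSpace X] [MulAction G X]
    (p q : MulAction.orbitRel.Quotient G X) : ℝ :=
  ⨅ z : p.orbit × q.orbit, dist (z.1 : X) (z.2 : X)

/-! ### Geodesic rays, horofunctions and horoballs -/

/-- The horofunction of a geodesic ray `γ`: the limit of `dist x (γ t) - t` as `t → ∞`. -/
noncomputable def horofunction {X : Type*} [MetricSpace X] (γ : ℝ≥0 → X) (x : X) : ℝ :=
  limUnder atTop (fun t : ℝ≥0 => dist x (γ t) - (t : ℝ))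

/-- The limit that defines the horofunction of a geodesic ray exists. -/
theorem tendsto_horofunction {X : Type*} [MetricSpace X] {γ : ℝ≥0 → X} (hγ : Isometry γ) (x : X) :
    Tendsto (fun t : ℝ≥0 => dist x (γ t) - (t : ℝ)) atTop (𝓝 (horofunction γ x)) := by
  have hanti : Antitone (fun t : ℝ≥0 => dist x (γ t) - (t : ℝ)) := by
    intro s t hst
    have h1 := dist_triangle x (γ s) (γ t)
    rw [hγ.dist_eq, NNReal.dist_eq, abs_sub_comm,
      abs_of_nonneg (sub_nonneg.2 (NNReal.coe_le_coe.2 hst))] at h1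
    show dist x (γ t) - (t : ℝ) ≤ dist x (γ s) - (s : ℝ)
    linarith
  have hbdd : BddBelow (Set.range (fun t : ℝ≥0 => dist x (γ t) - (t : ℝ))) := by
    refine ⟨-dist x (γ 0), ?_⟩
    rintro _ ⟨t, rfl⟩
    have h1 := dist_triangle_left (γ 0) (γ t) x
    rw [hγ.dist_eq, NNReal.dist_eq, abs_sub_comm] at h1
    simp only [NNReal.coe_zero, sub_zero, NNReal.abs_eq] at h1
    show -dist x (γ 0) ≤ dist x (γ t) - (t : ℝ)
    linarith
  exact tendsto_nhds_limUnder ⟨_, tendsto_atTop_ciInf hanti hbdd⟩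

/-- A horoball: the region on the inner side of a horosphere, that is, of a level set of the
horofunction of a geodesic ray. -/
def IsHoroball {X : Type*} [MetricSpace X] (B : Set X) : Prop :=
  ∃ (γ : ℝ≥0 → X) (r : ℝ), Isometry γ ∧ B = {x | horofunction γ x < r}

/-- Two geodesic rays have the same endpoint at infinity. -/
def SameEndpoint {X : Type*} [MetricSpace X] (γ γ' : ℝ≥0 → X) : Prop :=
  ∃ C : ℝ, ∀ t, dist (γ t) (γ' t) ≤ C

/-! ### Relative hyperbolicity in the sense of Gromov -/

/-- The action of `G` on `X` exhibits `G` as hyperbolic relative to `H 0, …, H (k - 1)`. -/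
structure IsGromovAction {G : Type*} [Group G] {k : ℕ} (H : Fin k → Subgroup G)
    (X : Type*) [MetricSpace X] [MulAction G X] : Prop where
  complete : CompleteSpace X
  locallyCompact : LocallyCompactSpace X
  geodesic : IsGeodesicSpace X
  hyperbolic : GromovHyperbolic (fun x y : X => dist x y)
  isometric : IsIsometricSMul G X
  properlyDiscontinuous : ProperlyDiscontinuousSMul G X
  free : ∀ (g : G) (x : X), g • x = x → g = 1
  /-- The quotient `X/G` is quasi-isometric to the union of `k` rays joined at zero; the rays lift
  to geodesic rays `γ i` of `X` (the image of `γ i` in `X/G` goes to infinity along the `i`-th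
  ray); `H i` is the isotropy group of the endpoint of `γ i`, and preserves the horofunction of
  `γ i`. -/
  rays : ∃ (f : MulAction.orbitRel.Quotient G X → RayWedge k) (γ : Fin k → ℝ≥0 → X),
    IsQuasiIsometry quotDist RayWedge.distance f ∧
    ∀ i, Isometry (γ i) ∧
      Tendsto (fun t => (f (Quotient.mk'' (γ i t))).1 i) atTop atTop ∧
      (∀ g : G, g ∈ H i ↔ SameEndpoint (fun t => g • γ i t) (γ i)) ∧
      ∀ g ∈ H i, ∀ x, horofunction (γ i) (g • x) = horofunction (γ i) x
  /-- There is a `G`-invariant system of disjoint horoballs with cocompact complement. -/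
  horoballs : ∃ 𝓑 : Set (Set X),
    (∀ B ∈ 𝓑, IsHoroball B) ∧
    (∀ (g : G), ∀ B ∈ 𝓑, (fun x => g • x) '' B ∈ 𝓑) ∧
    𝓑.PairwiseDisjoint id ∧
    ∃ K : Set X, IsCompact K ∧ K ⊆ (⋃₀ 𝓑)ᶜ ∧ (⋃₀ 𝓑)ᶜ ⊆ ⋃ g : G, (fun x => g • x) '' K

/-- `G` is hyperbolic relative to `H 0, …, H (k - 1)` in the sense of Gromov. -/
def HyperbolicRelGromov.{u, v} {G : Type u} [Group G] {k : ℕ} (H : Fin k → Subgroup G) : Prop :=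
  ∃ (X : Type v) (_ : MetricSpace X) (_ : MulAction G X), IsGromovAction H X

/-! ### The coned-off Cayley graph -/

variable {G : Type*} [Group G] {k : ℕ}

/-- The cone vertices: the left cosets `gHᵢ`, for all `i`. -/
abbrev Cone (H : Fin k → Subgroup G) : Type _ := Σ i : Fin k, G ⧸ H i

/-- The coned-off graph: the Cayley graph of `G` with respect to `A`, with a further vertex for
each left coset `gHᵢ`, joined to each element of `gHᵢ`. -/
def conedOff (H : Fin k → Subgroup G) (A : Set G) : SimpleGraph (G ⊕ Cone H) where
  Adj
    | .inl x, .inl y => (SimpleGraph.mulCayley A).Adj x y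
    | .inl x, .inr c => (x : G ⧸ H c.1) = c.2
    | .inr c, .inl x => (x : G ⧸ H c.1) = c.2
    | .inr _, .inr _ => False
  symm := ⟨by
    rintro (x | c) (y | d) h
    · exact h.symm
    · exact h
    · exact h
    · exact h⟩
  loopless := ⟨by
    rintro (x | c) h
    · exact (SimpleGraph.mulCayley A).irrefl h
    · exact h⟩

/-- Edges of the Cayley graph have length `1`, edges at a cone vertex have length `1/2`. -/
noncomputable def edgeLength {H : Fin k → Subgroup G} : G ⊕ Cone H → G ⊕ Cone H → ℝ
  | .inl _, .inl _ => 1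
  | _, _ => 1 / 2

/-- The length of a path in the coned-off graph. -/
noncomputable def pathLength {H : Fin k → Subgroup G} {A : Set G} {x y : G ⊕ Cone H}
    (p : (conedOff H A).Walk x y) : ℝ :=
  (p.darts.map fun e => edgeLength e.fst e.snd).sum

/-- The path metric of the coned-off graph, on its vertices. -/
noncomputable def conedDist (H : Fin k → Subgroup G) (A : Set G) (x y : G ⊕ Cone H) : ℝ :=
  ⨅ p : (conedOff H A).Walk x y, pathLength p

/-! ### Bounded coset penetration -/

/-- A path `p` in the coned-off graph is a `P`-quasigeodesic if the length of each of its subpaths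
is at most `P` times the distance between its endpoints, plus `P`. -/
def IsQuasigeodesic {H : Fin k → Subgroup G} {A : Set G} (P : ℝ) {x y : G ⊕ Cone H}
    (p : (conedOff H A).Walk x y) : Prop :=
  ∀ (v w : G ⊕ Cone H) (q : (conedOff H A).Walk v w), q.IsSubwalk p →
    pathLength q ≤ P * conedDist H A v w + P

/-- `Projects u p`: the path `p` in the coned-off graph is the projection of the path `u` in the
Cayley graph. Reading `u` from left to right, each maximal nonconstant subpath of `u` inside a left
coset `gHᵢ` is replaced by the path of length `1` through the cone vertex of `gHᵢ`; the edges of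
`u` that lie in no coset of any `Hᵢ` are kept. (For one subgroup, `u` has exactly one projection.
An edge whose label is in several of the `Hᵢ` may be attributed to any of them.) -/
inductive Projects (H : Fin k → Subgroup G) (A : Set G) :
    ∀ {x y : G}, (SimpleGraph.mulCayley A).Walk x y →
      (conedOff H A).Walk (Sum.inl x) (Sum.inl y) → Prop
  | nil (x : G) : Projects H A (SimpleGraph.Walk.nil : (SimpleGraph.mulCayley A).Walk x x)
      SimpleGraph.Walk.nil
  | edge {x y z : G} (h : (SimpleGraph.mulCayley A).Adj x y)
      (h' : (conedOff H A).Adj (Sum.inl x) (Sum.inl y))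
      (hH : ∀ i, x⁻¹ * y ∉ H i)
      (u : (SimpleGraph.mulCayley A).Walk y z) (p : (conedOff H A).Walk (Sum.inl y) (Sum.inl z)) :
      Projects H A u p →
      Projects H A (SimpleGraph.Walk.cons h u) (SimpleGraph.Walk.cons h' p)
  | coset {x y z : G} (i : Fin k) (w : (SimpleGraph.mulCayley A).Walk x y)
      (hw : ¬ w.Nil) (hwH : ∀ v ∈ w.support, x⁻¹ * v ∈ H i)
      (u : (SimpleGraph.mulCayley A).Walk y z) (hmax : u.Nil ∨ y⁻¹ * u.snd ∉ H i)
      (p : (conedOff H A).Walk (Sum.inl y) (Sum.inl z))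
      (hx : (conedOff H A).Adj (Sum.inl x) (Sum.inr ⟨i, (x : G ⧸ H i)⟩))
      (hy : (conedOff H A).Adj (Sum.inr ⟨i, (x : G ⧸ H i)⟩) (Sum.inl y)) :
      Projects H A u p →
      Projects H A (w.append u) (SimpleGraph.Walk.cons hx (SimpleGraph.Walk.cons hy p))

/-- The path penetrates the coset `c`: its projection passes through the cone vertex. -/
def Penetrates {H : Fin k → Subgroup G} {A : Set G} {x y : G ⊕ Cone H}
    (p : (conedOff H A).Walk x y) (c : Cone H) : Prop :=
  Sum.inr c ∈ p.support

/-- The path penetrates the coset `c`, entering it at `a` and leaving it at `b`. -/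
def PenetratesFromTo {H : Fin k → Subgroup G} {A : Set G} {x y : G ⊕ Cone H}
    (p : (conedOff H A).Walk x y) (c : Cone H) (a b : G) : Prop :=
  ∃ (q : (conedOff H A).Walk x (Sum.inl a)) (h₁ : (conedOff H A).Adj (Sum.inl a) (Sum.inr c))
    (h₂ : (conedOff H A).Adj (Sum.inr c) (Sum.inl b)) (r : (conedOff H A).Walk (Sum.inl b) y),
    p = q.append (SimpleGraph.Walk.cons h₁ (SimpleGraph.Walk.cons h₂ r))

/-- The path does not return to a coset that it has penetrated: its projection passes at most
once through each cone vertex. -/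
def WithoutBacktracking {H : Fin k → Subgroup G} {A : Set G} {x y : G ⊕ Cone H}
    (p : (conedOff H A).Walk x y) : Prop :=
  ∀ (c : Cone H) (m n : ℕ), m ≤ p.length → n ≤ p.length →
    p.getVert m = Sum.inr c → p.getVert n = Sum.inr c → m = n

/-- The Bounded Coset Penetration property, for the generating set `A`. -/
def BoundedCosetPenetration (H : Fin k → Subgroup G) (A : Set G) : Prop :=
  ∀ P : ℝ, 1 ≤ P → ∃ C : ℝ, ∀ (x y : G) (u v : (SimpleGraph.mulCayley A).Walk x y)
    (p q : (conedOff H A).Walk (Sum.inl x) (Sum.inl y)),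
    Projects H A u p → Projects H A v q →
    IsQuasigeodesic P p → IsQuasigeodesic P q →
    WithoutBacktracking p → WithoutBacktracking q →
    ∀ (c : Cone H) (a b : G), PenetratesFromTo p c a b →
      (¬ Penetrates q c → ((SimpleGraph.mulCayley A).dist a b : ℝ) ≤ C) ∧
      ∀ a' b' : G, PenetratesFromTo q c a' b' →
        ((SimpleGraph.mulCayley A).dist a a' : ℝ) ≤ C ∧
        ((SimpleGraph.mulCayley A).dist b b' : ℝ) ≤ C

/-- `G` is hyperbolic relative to `H 0, …, H (k - 1)` in the sense of Farb: for every finite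
generating set, the coned-off graph is hyperbolic and bounded coset penetration holds. -/
def HyperbolicRelFarb (H : Fin k → Subgroup G) : Prop :=
  ∀ A : Set G, A.Finite → Subgroup.closure A = ⊤ →
    GromovHyperbolic (conedDist H A) ∧ BoundedCosetPenetration H A

end RelHyp

universe u v

/-! The coned-off graph is, coarsely, `X` with each horoball collapsed to a point. Relate a point of
`X` to the group elements whose orbit points are near it and to the cosets whose horoballs contain
it up to a bounded error (`CloseTo`). This relation is coarsely Lipschitz
(`exists_conedDist_le_mul`), and the points related to one vertex form a coarsely convex set
(`exists_conedDist_le_of_between`), because sublevel sets of horofunctions are coarsely convex.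

The central result is a Morse lemma, `exists_conedDist_le_of_isQuasigeodesicSeq`: an `X`-geodesic,
seen in the coned-off graph, stays near every quasigeodesic with the same ends. It is proved before
the coned-off graph is known to be hyperbolic. Repeated bisection in `X` shows that a geodesic is
within `O(log n)` of any path of `n` edges (`exists_conedDist_le_log`), and the classical argument
by exponential divergence improves this to a constant. Applied to almost geodesics of the coned-off
graph, it transfers the four-point condition from `X`.

For coset penetration, `horoProj` measures the gap between the projections of two points to a
horosphere. It satisfies a coarse ultrametric inequality. If it is large, the geodesic between the
points goes deep into the horoball, so by the Morse lemma a quasigeodesic between them comes near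
the cone vertex. Hence a quasigeodesic that misses the cone vertex has bounded projection
(`exists_horoProj_le`). Entry and exit points lie near the horosphere, where bounded projection
means bounded distance in `X`, and so in `Γ` by proper discontinuity.

All this uses only the coarse properties listed in `HoroballSystem`. They are deduced from Gromov's
definition in `IsGromovAction.exists_horoballSystem`: the functions are the horofunctions of the
translated rays `γ i`, shifted so that their sublevel sets lie in the given disjoint horoballs. -/

namespace RelHyp

/-! ### The path metric of the coned-off graph. -/

section ConedOffDistance

variable {G : Type*} [Group G] {k : ℕ} {H : Fin k → Subgroup G} {A : Set G}

lemma half_le_edgeLength (x y : G ⊕ Cone H) : 1 / 2 ≤ edgeLength x y := by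
  rcases x with x | x <;> rcases y with y | y <;> norm_num [edgeLength]

lemma edgeLength_le_one (x y : G ⊕ Cone H) : edgeLength x y ≤ 1 := by
  rcases x with x | x <;> rcases y with y | y <;> norm_num [edgeLength]

lemma edgeLength_comm (x y : G ⊕ Cone H) : edgeLength x y = edgeLength y x := by
  rcases x with x | x <;> rcases y with y | y <;> rfl

@[simp] lemma pathLength_nil (x : G ⊕ Cone H) :
    pathLength (SimpleGraph.Walk.nil : (conedOff H A).Walk x x) = 0 := rfl

@[simp] lemma pathLength_cons {x y z : G ⊕ Cone H} (h : (conedOff H A).Adj x y)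
    (p : (conedOff H A).Walk y z) :
    pathLength (SimpleGraph.Walk.cons h p) = edgeLength x y + pathLength p := rfl

lemma pathLength_append {x y z : G ⊕ Cone H} (p : (conedOff H A).Walk x y)
    (q : (conedOff H A).Walk y z) : pathLength (p.append q) = pathLength p + pathLength q := by
  simp [pathLength, SimpleGraph.Walk.darts_append]

lemma pathLength_reverse {x y : G ⊕ Cone H} (p : (conedOff H A).Walk x y) :
    pathLength p.reverse = pathLength p := by
  induction p with
  | nil => rfl
  | cons h p ih =>
    rw [SimpleGraph.Walk.reverse_cons, pathLength_append, ih, pathLength_cons, pathLength_cons,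
      pathLength_nil, edgeLength_comm]
    ring

lemma pathLength_le_length {x y : G ⊕ Cone H} (p : (conedOff H A).Walk x y) :
    pathLength p ≤ p.length := by
  induction p with
  | nil => simp
  | @cons a b c h p ih =>
    rw [pathLength_cons, SimpleGraph.Walk.length_cons]
    push_cast
    linarith [edgeLength_le_one (H := H) a b]

lemma length_le_two_mul_pathLength {x y : G ⊕ Cone H} (p : (conedOff H A).Walk x y) :
    (p.length : ℝ) ≤ 2 * pathLength p := by
  induction p with
  | nil => simp
  | @cons a b c h p ih =>
    rw [pathLength_cons, SimpleGraph.Walk.length_cons]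
    push_cast
    linarith [half_le_edgeLength (H := H) a b]

lemma pathLength_nonneg {x y : G ⊕ Cone H} (p : (conedOff H A).Walk x y) : 0 ≤ pathLength p := by
  have := length_le_two_mul_pathLength p
  have : (0 : ℝ) ≤ p.length := by positivity
  linarith

lemma conedDist_le_pathLength {x y : G ⊕ Cone H} (p : (conedOff H A).Walk x y) :
    conedDist H A x y ≤ pathLength p :=
  ciInf_le ⟨0, by rintro _ ⟨p, rfl⟩; exact pathLength_nonneg p⟩ p

lemma conedDist_nonneg (x y : G ⊕ Cone H) : 0 ≤ conedDist H A x y :=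
  Real.iInf_nonneg pathLength_nonneg

@[simp] lemma conedDist_self (x : G ⊕ Cone H) : conedDist H A x x = 0 :=
  le_antisymm (conedDist_le_pathLength SimpleGraph.Walk.nil) (conedDist_nonneg x x)

lemma conedDist_le_one_of_adj {x y : G ⊕ Cone H} (h : (conedOff H A).Adj x y) :
    conedDist H A x y ≤ 1 := by
  refine (conedDist_le_pathLength (SimpleGraph.Walk.cons h .nil)).trans ?_
  simpa using edgeLength_le_one x y

/-- The right translation by an element displaces all vertices of the Cayley graph by a bounded
amount. -/
lemma exists_walk_mul_right (hA : Subgroup.closure A = ⊤) (s : G) :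
    ∃ n : ℕ, ∀ g : G, ∃ p : (SimpleGraph.mulCayley A).Walk g (g * s), p.length ≤ n := by
  have hs : s ∈ Subgroup.closure A := hA ▸ Subgroup.mem_top s
  induction hs using Subgroup.closure_induction with
  | mem a ha =>
    refine ⟨1, fun g => ?_⟩
    by_cases h : g = g * a
    · exact ⟨SimpleGraph.Walk.nil.copy rfl h, by simp⟩
    · have : (SimpleGraph.mulCayley A).Adj g (g * a) := by
        rw [SimpleGraph.mulCayley_adj']
        exact ⟨h, a, ha, Or.inl rfl⟩
      exact ⟨this.toWalk, by simp⟩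
  | one => exact ⟨0, fun g => ⟨SimpleGraph.Walk.nil.copy rfl (by simp), by simp⟩⟩
  | mul a b _ _ iha ihb =>
    obtain ⟨n, hn⟩ := iha
    obtain ⟨m, hm⟩ := ihb
    refine ⟨n + m, fun g => ?_⟩
    obtain ⟨p, hp⟩ := hn g
    obtain ⟨q, hq⟩ := hm (g * a)
    refine ⟨(p.append q).copy rfl (by group), ?_⟩
    simp only [SimpleGraph.Walk.length_copy, SimpleGraph.Walk.length_append]
    omega
  | inv a _ iha =>
    obtain ⟨n, hn⟩ := iha
    refine ⟨n, fun g => ?_⟩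
    obtain ⟨p, hp⟩ := hn (g * a⁻¹)
    exact ⟨p.reverse.copy (by group) rfl, by simpa using hp⟩

/-- The inclusion of the Cayley graph in the coned-off graph. -/
def cayleyHom (H : Fin k → Subgroup G) (A : Set G) : SimpleGraph.mulCayley A →g conedOff H A where
  toFun := Sum.inl
  map_rel' h := h

lemma exists_conedWalk (hA : Subgroup.closure A = ⊤) (x y : G ⊕ Cone H) :
    Nonempty ((conedOff H A).Walk x y) := by
  have key : ∀ g g' : G, Nonempty ((conedOff H A).Walk (Sum.inl g) (Sum.inl g')) := by
    intro g g'
    obtain ⟨n, hn⟩ := exists_walk_mul_right hA (g⁻¹ * g')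
    obtain ⟨p, -⟩ := hn g
    exact ⟨(p.copy rfl (by group)).map (cayleyHom H A)⟩
  have key2 : ∀ x : G ⊕ Cone H, ∃ g, Nonempty ((conedOff H A).Walk x (Sum.inl g)) := by
    rintro (g | c)
    · exact ⟨g, ⟨.nil⟩⟩
    · have : (conedOff H A).Adj (Sum.inr c) (Sum.inl c.2.out) := QuotientGroup.out_eq' c.2
      exact ⟨_, ⟨this.toWalk⟩⟩
  obtain ⟨g, ⟨p⟩⟩ := key2 x
  obtain ⟨g', ⟨p'⟩⟩ := key2 y
  obtain ⟨q⟩ := key g g'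
  exact ⟨(p.append q).append p'.reverse⟩

lemma exists_pathLength_lt (hA : Subgroup.closure A = ⊤) (x y : G ⊕ Cone H) {ε : ℝ} (hε : 0 < ε) :
    ∃ p : (conedOff H A).Walk x y, pathLength p < conedDist H A x y + ε := by
  have := exists_conedWalk hA x y
  exact exists_lt_of_ciInf_lt (lt_add_of_pos_right _ hε)

lemma conedDist_comm (hA : Subgroup.closure A = ⊤) (x y : G ⊕ Cone H) :
    conedDist H A x y = conedDist H A y x := by
  have key : ∀ x y : G ⊕ Cone H, conedDist H A x y ≤ conedDist H A y x := by
    intro x y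
    refine le_of_forall_pos_le_add fun ε hε => ?_
    obtain ⟨p, hp⟩ := exists_pathLength_lt hA y x hε
    have := conedDist_le_pathLength p.reverse
    rw [pathLength_reverse] at this
    linarith
  exact le_antisymm (key x y) (key y x)

lemma conedDist_triangle (hA : Subgroup.closure A = ⊤) (x y z : G ⊕ Cone H) :
    conedDist H A x z ≤ conedDist H A x y + conedDist H A y z := by
  refine le_of_forall_pos_le_add fun ε hε => ?_
  obtain ⟨p, hp⟩ := exists_pathLength_lt hA x y (half_pos hε)
  obtain ⟨q, hq⟩ := exists_pathLength_lt hA y z (half_pos hε)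
  have := conedDist_le_pathLength (p.append q)
  rw [pathLength_append] at this
  linarith

lemma conedDist_inl_mul_right (hA : Subgroup.closure A = ⊤) (s : G) :
    ∃ n : ℝ, 0 ≤ n ∧ ∀ g : G, conedDist H A (Sum.inl g) (Sum.inl (g * s)) ≤ n := by
  obtain ⟨n, hn⟩ := exists_walk_mul_right hA s
  refine ⟨n, n.cast_nonneg, fun g => ?_⟩
  obtain ⟨p, hp⟩ := hn g
  refine (conedDist_le_pathLength (p.map (cayleyHom H A))).trans
    ((pathLength_le_length _).trans ?_)
  rw [SimpleGraph.Walk.length_map]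
  exact_mod_cast hp

/-- The part of a walk between its vertices number `i` and `j`. -/
lemma exists_subwalk {V : Type*} {Γ : SimpleGraph V} {x y : V} (p : Γ.Walk x y) {i j : ℕ}
    (hij : i ≤ j) (hj : j ≤ p.length) :
    ∃ q : Γ.Walk (p.getVert i) (p.getVert j), q.IsSubwalk p ∧ q.length = j - i := by
  have hv : (p.drop i).getVert (j - i) = p.getVert j := by
    rw [SimpleGraph.Walk.drop_getVert]
    congr 1
    omega
  refine ⟨((p.drop i).take (j - i)).copy rfl hv, ?_, ?_⟩
  · have := (SimpleGraph.Walk.isSubwalk_take (p.drop i) (j - i)).trans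
      (SimpleGraph.Walk.isSubwalk_drop p i)
    exact this.copy rfl hv rfl rfl
  · rw [SimpleGraph.Walk.length_copy, SimpleGraph.Walk.take_length, SimpleGraph.Walk.drop_length]
    omega

/-- The sequence `v a, …, v b` is a path in the coned-off graph that is quasigeodesic with
constant `P`, in terms of the number of edges. -/
structure IsQuasigeodesicSeq (H : Fin k → Subgroup G) (A : Set G) (P : ℝ) (v : ℕ → G ⊕ Cone H)
    (a b : ℕ) : Prop where
  adj : ∀ i, a ≤ i → i < b → (conedOff H A).Adj (v i) (v (i + 1))
  le : ∀ i j, a ≤ i → i ≤ j → j ≤ b → (j : ℝ) - i ≤ P * conedDist H A (v i) (v j) + P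

lemma IsQuasigeodesicSeq.mono {P : ℝ} {v : ℕ → G ⊕ Cone H} {a b a' b' : ℕ}
    (h : IsQuasigeodesicSeq H A P v a b) (ha : a ≤ a') (hb : b' ≤ b) :
    IsQuasigeodesicSeq H A P v a' b' :=
  ⟨fun i hi hi' => h.adj i (ha.trans hi) (hi'.trans_le hb),
    fun i j hi hij hj => h.le i j (ha.trans hi) hij (hj.trans hb)⟩

/-- Edges at cone vertices have length `1/2`, so counting edges instead of length doubles the
constant. -/
lemma IsQuasigeodesic.seq {P : ℝ} {x y : G ⊕ Cone H} {p : (conedOff H A).Walk x y}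
    (h : IsQuasigeodesic P p) : IsQuasigeodesicSeq H A (2 * P) p.getVert 0 p.length := by
  refine ⟨fun i _ hi => p.adj_getVert_succ hi, fun i j _ hij hj => ?_⟩
  obtain ⟨q, hq, hql⟩ := exists_subwalk p hij hj
  have h1 := h _ _ q hq
  have h2 := length_le_two_mul_pathLength q
  rw [hql, Nat.cast_sub hij] at h2
  linarith

lemma IsQuasigeodesic.subwalk {P : ℝ} {x y z w : G ⊕ Cone H} {p : (conedOff H A).Walk x y}
    (h : IsQuasigeodesic P p) {q : (conedOff H A).Walk z w} (hq : q.IsSubwalk p) :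
    IsQuasigeodesic P q :=
  fun v w r hr => h v w r (hr.trans hq)

/-- Any two vertices are joined by a path whose subpaths are geodesic up to an error of `1`. -/
lemma exists_almost_geodesic (hA : Subgroup.closure A = ⊤) (x y : G ⊕ Cone H) :
    ∃ p : (conedOff H A).Walk x y, IsQuasigeodesic 1 p ∧
      (p.length : ℝ) ≤ 2 * conedDist H A x y + 2 ∧
      ∀ i ≤ p.length, conedDist H A x (p.getVert i) + conedDist H A (p.getVert i) y ≤
        conedDist H A x y + 1 := by
  obtain ⟨p, hp⟩ := exists_pathLength_lt hA x y one_pos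
  refine ⟨p, ?_, ?_, ?_⟩
  -- The excess of a subpath over the distance between its ends is at most the excess of the whole
  -- path, which is less than `1`.
  · rintro v w q ⟨r, s, hrs⟩
    have h1 := conedDist_le_pathLength r
    have h2 := conedDist_le_pathLength s
    have h3 := conedDist_triangle hA x v y
    have h4 := conedDist_triangle hA v w y
    rw [hrs, pathLength_append, pathLength_append] at hp
    linarith
  · linarith [length_le_two_mul_pathLength p]
  · intro i hi
    have h1 := conedDist_le_pathLength (p.take i)
    have h2 := conedDist_le_pathLength (p.drop i)
    have h3 : pathLength (p.take i) + pathLength (p.drop i) = pathLength p := by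
      rw [← pathLength_append, SimpleGraph.Walk.append_take_drop_eq]
    linarith

end ConedOffDistance

/-! ### Coarse betweenness in a hyperbolic space. -/

section Betweenness

variable {X : Type*} [MetricSpace X]

/-- The four-point condition with constant `δ`. -/
def FourPoint (X : Type*) [MetricSpace X] (δ : ℝ) : Prop :=
  ∀ x y z w : X, dist x y + dist z w ≤ max (dist x z + dist y w) (dist x w + dist y z) + 2 * δ

/-- The point `m` lies between `x` and `y`, up to an error of `C`. -/
def Between (C : ℝ) (x y m : X) : Prop := dist x m + dist m y ≤ dist x y + C

lemma Between.mono {C C' : ℝ} {x y m : X} (h : Between C x y m) (hC : C ≤ C') :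
    Between C' x y m :=
  h.trans (by linarith)

lemma Between.symm {C : ℝ} {x y m : X} (h : Between C x y m) : Between C y x m := by
  unfold Between at *
  rw [dist_comm y x, dist_comm y m, dist_comm m x]
  linarith

lemma between_left (x y : X) : Between 0 x y x := by simp [Between]

lemma between_right (x y : X) : Between 0 x y y := by simp [Between]

/-- This is the form in which thinness of triangles is used throughout: the four-point condition for
`x, y, m, z` puts `m` on one of the other two sides, at the cost of `2 * δ`. -/
lemma FourPoint.between_or {δ C : ℝ} (hδ : FourPoint X δ) {x y m : X} (h : Between C x y m)
    (z : X) : Between (C + 2 * δ) x z m ∨ Between (C + 2 * δ) z y m := by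
  have h1 := hδ x y m z
  unfold Between at *
  rw [dist_comm z y, dist_comm z m]
  rcases le_total (dist x m + dist y z) (dist x z + dist y m) with h2 | h2
  · rw [max_eq_right h2, dist_comm y m] at h1
    left
    linarith
  · rw [max_eq_left h2] at h1
    right
    linarith

lemma Between.between_of_between {x y m z z' : X} (hm : Between 0 x y m) (hz : Between 0 x m z)
    (hz' : Between 0 y m z') : Between 0 z z' m := by
  unfold Between at *
  have h1 := dist_triangle4 x z z' y
  rw [dist_comm y z', dist_comm z' m, dist_comm y m] at hz'
  linarith

lemma Between.trans {x y m z : X} (hm : Between 0 x y m) (hz : Between 0 x m z) :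
    Between 0 x y z := by
  unfold Between at *
  linarith [dist_triangle z m y]

lemma IsGeodesicSpace.exists_dist_eq (hX : IsGeodesicSpace X) (x y : X) {t : ℝ} (ht : 0 ≤ t)
    (ht' : t ≤ dist x y) : ∃ m, dist x m = t ∧ dist m y = dist x y - t := by
  obtain ⟨c, h0, h1, hc⟩ := hX x y
  refine ⟨c t, ?_, ?_⟩
  · rw [← h0, hc 0 ⟨le_rfl, dist_nonneg⟩ t ⟨ht, ht'⟩, zero_sub, abs_neg, abs_of_nonneg ht]
  · conv_lhs => rw [← h1]
    rw [hc t ⟨ht, ht'⟩ _ ⟨dist_nonneg, le_rfl⟩, abs_sub_comm, abs_of_nonneg (by linarith)]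

lemma IsGeodesicSpace.exists_path (hX : IsGeodesicSpace X) (x y : X) :
    ∃ c : ℝ → X, c 0 = x ∧ c (dist x y) = y ∧ ContinuousOn c (Set.Icc 0 (dist x y)) ∧
      (∀ t ∈ Set.Icc 0 (dist x y), dist x (c t) = t ∧ dist (c t) y = dist x y - t) ∧
      ∀ s ∈ Set.Icc 0 (dist x y), ∀ t ∈ Set.Icc 0 (dist x y), dist (c s) (c t) = |s - t| := by
  obtain ⟨c, h0, h1, hc⟩ := hX x y
  refine ⟨c, h0, h1, ?_, fun t ht => ⟨?_, ?_⟩, hc⟩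
  · refine LipschitzOnWith.continuousOn (K := 1) (LipschitzOnWith.of_dist_le_mul ?_)
    intro s hs t ht
    rw [hc s hs t ht, NNReal.coe_one, one_mul, Real.dist_eq]
  · conv_lhs => rw [← h0]
    rw [hc 0 ⟨le_rfl, dist_nonneg⟩ t ht, zero_sub, abs_neg, abs_of_nonneg ht.1]
  · conv_lhs => rw [← h1]
    rw [hc t ht _ ⟨dist_nonneg, le_rfl⟩, abs_sub_comm, abs_of_nonneg (by linarith [ht.2])]

end Betweenness

/-! ### Horoball systems and the coarse map from `X` to the coned-off graph. -/

section HoroballSystem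

variable {G : Type*} [Group G] {k : ℕ}

/-- A system of functions `h c` on `X`, indexed by the cosets of the groups `H i`, with the coarse
properties of the horofunctions of the parabolic points, normalised in such a way that the
horoballs `h c ≤ 0` are disjoint. -/
structure HoroballSystem (H : Fin k → Subgroup G) {X : Type*} [MetricSpace X] [MulAction G X]
    (δ R : ℝ) (x₀ : X) (h : Cone H → X → ℝ) : Prop where
  geodesic : IsGeodesicSpace X
  isometric : IsIsometricSMul G X
  fourPoint : FourPoint X δ
  nonneg_δ : 0 ≤ δ
  nonneg_R : 0 ≤ R
  fourPoint_horo : ∀ c x y z, dist x y + h c z ≤ max (dist x z + h c y) (h c x + dist y z) + 2 * δ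
  lipschitz : ∀ c x y, h c x ≤ h c y + dist x y
  descend : ∀ c x s, 0 ≤ s → ∃ p, dist x p ≤ s + 1 ∧ h c p ≤ h c x - s
  disjoint : ∀ c c' x, h c x ≤ 0 → h c' x ≤ 0 → c = c'
  cobounded : ∀ p, (∃ c, h c p < 0) ∨ ∃ g : G, dist p (g • x₀) ≤ R
  upper : ∀ (c : Cone H) (g : G), (g : G ⧸ H c.1) = c.2 → h c (g • x₀) ≤ R
  lower : ∀ c (g : G), -R ≤ h c (g • x₀)
  finite_orbit : ∀ r, {g : G | dist x₀ (g • x₀) ≤ r}.Finite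
  finite_cone : ∀ r, {c | h c x₀ ≤ r}.Finite
  equivariant : ∀ (g : G) (c : Cone H) x, h ⟨c.1, g • c.2⟩ (g • x) = h c x

variable {H : Fin k → Subgroup G} {A : Set G} {X : Type*} [MetricSpace X] [MulAction G X]
  {δ R : ℝ} {x₀ : X} {h : Cone H → X → ℝ}

/-- Allows `R` to be enlarged until it also bounds the displacement of `x₀` by the generators in
`A`. -/
lemma HoroballSystem.mono (S : HoroballSystem H δ R x₀ h) {R' : ℝ} (hR : R ≤ R') :
    HoroballSystem H δ R' x₀ h :=
  { S with
    nonneg_R := S.nonneg_R.trans hR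
    cobounded := fun p => (S.cobounded p).imp id fun ⟨g, hg⟩ => ⟨g, hg.trans hR⟩
    upper := fun c g hg => (S.upper c g hg).trans hR
    lower := fun c g => by linarith [S.lower c g] }

/-- The point `z` of `X` is close to the vertex `v` of the coned-off graph. -/
def CloseTo (R : ℝ) (x₀ : X) (h : Cone H → X → ℝ) (z : X) : G ⊕ Cone H → Prop
  | .inl g => dist z (g • x₀) ≤ R
  | .inr c => h c z ≤ R

/-- A point of `X` representing a vertex of the coned-off graph. -/
noncomputable def vertexPoint (H : Fin k → Subgroup G) (x₀ : X) : G ⊕ Cone H → X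
  | .inl g => g • x₀
  | .inr c => (Quotient.out c.2 : G) • x₀

namespace HoroballSystem

lemma exists_closeTo (S : HoroballSystem H δ R x₀ h) (z : X) : ∃ v, CloseTo R x₀ h z v := by
  rcases S.cobounded z with ⟨c, hc⟩ | ⟨g, hg⟩
  · exact ⟨.inr c, hc.le.trans S.nonneg_R⟩
  · exact ⟨.inl g, hg⟩

lemma closeTo_vertexPoint (S : HoroballSystem H δ R x₀ h) (v : G ⊕ Cone H) :
    CloseTo R x₀ h (vertexPoint H x₀ v) v := by
  rcases v with g | c
  · simpa [CloseTo, vertexPoint] using S.nonneg_R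
  · exact S.upper c _ (QuotientGroup.out_eq' c.2)

lemma lower_vertexPoint (S : HoroballSystem H δ R x₀ h) (c : Cone H) (v : G ⊕ Cone H) :
    -R ≤ h c (vertexPoint H x₀ v) := by
  rcases v with g | d
  · exact S.lower c g
  · exact S.lower c _

lemma dist_smul (S : HoroballSystem H δ R x₀ h) (g : G) (x y : X) :
    dist (g • x) (g • y) = dist x y :=
  have := S.isometric
  _root_.dist_smul g x y

lemma dist_orbit (S : HoroballSystem H δ R x₀ h) (g g' : G) :
    dist (g • x₀) (g' • x₀) = dist x₀ ((g⁻¹ * g') • x₀) := by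
  rw [← S.dist_smul g⁻¹ (g • x₀), inv_smul_smul, smul_smul]

lemma adj_dist_le (S : HoroballSystem H δ R x₀ h) (hAR : ∀ a ∈ A, dist x₀ (a • x₀) ≤ R)
    {g g' : G} (hg : (SimpleGraph.mulCayley A).Adj g g') : dist (g • x₀) (g' • x₀) ≤ R := by
  rw [SimpleGraph.mulCayley_adj'] at hg
  obtain ⟨-, a, ha, rfl | rfl⟩ := hg
  · rw [S.dist_orbit]
    simpa using hAR a ha
  · rw [dist_comm, S.dist_orbit]
    simpa using hAR a ha

/-- For an edge at a cone vertex take that cone vertex; for a Cayley edge either end serves. A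
single edge thus lies in one coarsely convex fibre of `CloseTo`. -/
lemma adj_closeTo (S : HoroballSystem H δ R x₀ h) (hAR : ∀ a ∈ A, dist x₀ (a • x₀) ≤ R)
    {v v' : G ⊕ Cone H} (hv : (conedOff H A).Adj v v') :
    ∃ e, (e = v ∨ e = v') ∧ CloseTo R x₀ h (vertexPoint H x₀ v) e ∧
      CloseTo R x₀ h (vertexPoint H x₀ v') e := by
  rcases v with g | c <;> rcases v' with g' | c'
  · refine ⟨.inl g, Or.inl rfl, S.closeTo_vertexPoint _, ?_⟩
    have := S.adj_dist_le hAR (g := g) (g' := g') hv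
    rwa [dist_comm] at this
  · exact ⟨.inr c', Or.inr rfl, S.upper c' g hv, S.closeTo_vertexPoint _⟩
  · exact ⟨.inr c, Or.inl rfl, S.closeTo_vertexPoint _, S.upper c g' hv⟩
  · exact hv.elim

/-- Group elements whose orbit points are close are close in the Cayley graph. -/
lemma exists_cayley_dist_le (S : HoroballSystem H δ R x₀ h) (hA : Subgroup.closure A = ⊤)
    (r : ℝ) : ∃ M : ℝ, ∀ g g' : G, dist (g • x₀) (g' • x₀) ≤ r →
      ∃ p : (SimpleGraph.mulCayley A).Walk g g', (p.length : ℝ) ≤ M := by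
  choose n hn using exists_walk_mul_right hA
  obtain ⟨M, hM⟩ := ((S.finite_orbit r).image n).bddAbove
  refine ⟨M, fun g g' hg => ?_⟩
  rw [S.dist_orbit] at hg
  obtain ⟨p, hp⟩ := hn (g⁻¹ * g') g
  refine ⟨p.copy rfl (by group), ?_⟩
  rw [SimpleGraph.Walk.length_copy]
  exact_mod_cast hp.trans (hM ⟨_, hg, rfl⟩)

lemma exists_conedDist_inl_le (S : HoroballSystem H δ R x₀ h) (hA : Subgroup.closure A = ⊤)
    (r : ℝ) : ∃ M : ℝ, ∀ g g' : G, dist (g • x₀) (g' • x₀) ≤ r →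
      conedDist H A (.inl g) (.inl g') ≤ M := by
  obtain ⟨M, hM⟩ := S.exists_cayley_dist_le hA r
  refine ⟨M, fun g g' hg => ?_⟩
  obtain ⟨p, hp⟩ := hM g g' hg
  refine (conedDist_le_pathLength (p.map (cayleyHom H A))).trans
    ((pathLength_le_length _).trans ?_)
  rwa [SimpleGraph.Walk.length_map]

/-- After translation by `g⁻¹` only finitely many cosets are involved. A representative `s` of the
translated coset gives a vertex `g * s` of `c` at bounded distance from `g`. -/
lemma exists_conedDist_cone_le (S : HoroballSystem H δ R x₀ h) (hA : Subgroup.closure A = ⊤)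
    (r : ℝ) : ∃ M : ℝ, ∀ (g : G) (c : Cone H), h c (g • x₀) ≤ r →
      conedDist H A (.inl g) (.inr c) ≤ M := by
  choose n hn0 hn using conedDist_inl_mul_right (H := H) hA
  obtain ⟨M, hM⟩ := ((S.finite_cone r).image fun c : Cone H => n (Quotient.out c.2 : G)).bddAbove
  refine ⟨M + 1, fun g c hg => ?_⟩
  have h1 : h ⟨c.1, g⁻¹ • c.2⟩ x₀ ≤ r := by
    have := S.equivariant g⁻¹ c (g • x₀)
    rw [inv_smul_smul] at this
    linarith
  set s : G := Quotient.out (g⁻¹ • c.2) with hs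
  have h2 : n s ≤ M := hM ⟨⟨c.1, g⁻¹ • c.2⟩, h1, rfl⟩
  have h3 : (conedOff H A).Adj (.inl (g * s)) (.inr c) := by
    change ((g * s : G) : G ⧸ H c.1) = c.2
    have : ((s : G) : G ⧸ H c.1) = g⁻¹ • c.2 := QuotientGroup.out_eq' _
    calc ((g * s : G) : G ⧸ H c.1) = g • ((s : G) : G ⧸ H c.1) := rfl
      _ = c.2 := by rw [this, smul_inv_smul]
  linarith [conedDist_triangle hA (.inl g) (.inl (g * s)) (.inr c), hn s g,
    conedDist_le_one_of_adj h3]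

lemma conedDist_cone_cone_le (S : HoroballSystem H δ R x₀ h) (hA : Subgroup.closure A = ⊤)
    (r : ℝ) : ∃ M : ℝ, 0 ≤ M ∧ ∀ (c c' : Cone H) (p q : X), h c p ≤ 0 → h c' q ≤ 0 →
      dist p q ≤ r → conedDist H A (.inr c) (.inr c') ≤ M := by
  obtain ⟨M₁, hM₁⟩ := S.exists_conedDist_cone_le hA R
  obtain ⟨M₂, hM₂⟩ := S.exists_conedDist_cone_le hA (r + R)
  refine ⟨max 0 (M₁ + M₂), le_max_left _ _, fun c c' p q hp hq hpq => ?_⟩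
  by_cases hc : c = c'
  · subst hc
    simp
  have hq' : 0 < h c q := by
    by_contra! hcon
    exact hc (S.disjoint c c' q hcon hq)
  obtain ⟨γ, h0, h1, hcont, hγ, -⟩ := S.geodesic.exists_path p q
  have hlip : Continuous (h c) := by
    refine LipschitzWith.continuous (K := 1) (LipschitzWith.of_le_add fun x y => S.lipschitz c x y)
  have hivt := intermediate_value_Icc (dist_nonneg (x := p) (y := q))
    (hlip.comp_continuousOn hcont)
  obtain ⟨t, ht, hts⟩ := hivt (show (0 : ℝ) ∈ _ by
    simp only [Function.comp, h0, h1]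
    exact ⟨hp, hq'.le⟩)
  simp only [Function.comp] at hts
  -- At `γ t`, on the horosphere `h c = 0`, no horofunction is negative: by disjointness it would
  -- have to be `h c`. So an orbit point is within `R`, and it joins the two cone vertices.
  rcases S.cobounded (γ t) with ⟨d, hd⟩ | ⟨g, hg⟩
  · have := S.disjoint c d (γ t) hts.le hd.le
    subst this
    linarith
  · have h3 := S.lipschitz c (g • x₀) (γ t)
    have h4 := S.lipschitz c' (g • x₀) q
    have h5 := dist_triangle (g • x₀) (γ t) q
    rw [dist_comm (g • x₀) (γ t)] at h3 h5
    have h6 := (hγ t ht).2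
    have h7 := ht.1
    have h8 := hM₁ g c (by linarith)
    have h9 := hM₂ g c' (by linarith)
    have := conedDist_triangle hA (.inr c) (.inl g) (.inr c')
    rw [conedDist_comm hA (.inr c) (.inl g)] at this
    exact le_max_of_le_right (by linarith)

lemma exists_conedDist_le_of_dist_le_one (S : HoroballSystem H δ R x₀ h)
    (hA : Subgroup.closure A = ⊤) :
    ∃ M : ℝ, 0 ≤ M ∧ ∀ z z' v v', CloseTo R x₀ h z v → CloseTo R x₀ h z' v' → dist z z' ≤ 1 →
      conedDist H A v v' ≤ M := by
  obtain ⟨M₁, hM₁⟩ := S.exists_conedDist_inl_le hA (2 * R + 1)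
  obtain ⟨M₂, hM₂⟩ := S.exists_conedDist_cone_le hA (2 * R + 1)
  obtain ⟨M₃, hM₃0, hM₃⟩ := S.conedDist_cone_cone_le hA (2 * R + 3)
  have hcone : ∀ z z' (g : G) c, CloseTo R x₀ h z (.inl g) → CloseTo R x₀ h z' (.inr c) →
      dist z z' ≤ 1 → conedDist H A (.inl g) (.inr c) ≤ M₂ := by
    intro z z' g c hz hz' hd
    apply hM₂
    have h1 : dist z (g • x₀) ≤ R := hz
    have h2 : h c z' ≤ R := hz'
    have h3 := S.lipschitz c (g • x₀) z'
    have h4 := dist_triangle_left (g • x₀) z' z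
    linarith
  refine ⟨max M₁ (max M₂ M₃), le_max_of_le_right (le_max_of_le_right hM₃0), ?_⟩
  rintro z z' (g | c) (g' | c') hv hv' hd
  · refine le_max_of_le_left (hM₁ g g' ?_)
    have h1 : dist z (g • x₀) ≤ R := hv
    have h2 : dist z' (g' • x₀) ≤ R := hv'
    have h3 := dist_triangle4 (g • x₀) z z' (g' • x₀)
    rw [dist_comm (g • x₀) z] at h3
    linarith
  · exact le_max_of_le_right (le_max_of_le_left (hcone z z' g c' hv hv' hd))
  · rw [conedDist_comm hA]
    exact le_max_of_le_right (le_max_of_le_left (hcone z' z g' c hv' hv (by rwa [dist_comm])))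
  · refine le_max_of_le_right (le_max_of_le_right ?_)
    have h1 : h c z ≤ R := hv
    have h2 : h c' z' ≤ R := hv'
    -- Descending from level `R` to level `0` costs `R + 1` on each side; this explains the radius
    -- `2 * R + 3`.
    obtain ⟨p, hp, hp'⟩ := S.descend c z R S.nonneg_R
    obtain ⟨q, hq, hq'⟩ := S.descend c' z' R S.nonneg_R
    refine hM₃ c c' p q (by linarith) (by linarith) ?_
    have h3 := dist_triangle4 p z z' q
    rw [dist_comm p z] at h3
    linarith

/-- The map from `X` to the coned-off graph is coarsely Lipschitz. -/
lemma exists_conedDist_le_mul (S : HoroballSystem H δ R x₀ h) (hA : Subgroup.closure A = ⊤) :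
    ∃ M : ℝ, 0 ≤ M ∧ ∀ z z' v v', CloseTo R x₀ h z v → CloseTo R x₀ h z' v' →
      conedDist H A v v' ≤ M * (1 + dist z z') := by
  obtain ⟨M, hM0, hM⟩ := S.exists_conedDist_le_of_dist_le_one hA
  have key : ∀ n : ℕ, ∀ z z' v v', CloseTo R x₀ h z v → CloseTo R x₀ h z' v' → dist z z' ≤ n →
      conedDist H A v v' ≤ M * (n + 1) := by
    intro n
    induction n with
    | zero =>
      intro z z' v v' hv hv' hd
      have := hM z z' v v' hv hv' (by push_cast at hd; linarith)
      simpa using this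
    | succ n ih =>
      intro z z' v v' hv hv' hd
      push_cast at hd ⊢
      obtain ⟨m, hm, hm'⟩ := S.geodesic.exists_dist_eq z z' (t := min 1 (dist z z'))
        (le_min zero_le_one dist_nonneg) (min_le_right _ _)
      obtain ⟨u, hu⟩ := S.exists_closeTo m
      have h1 := hM z m v u hv hu (hm ▸ min_le_left _ _)
      have h2 : dist m z' ≤ n := by
        rw [hm']
        rcases le_total 1 (dist z z') with h3 | h3
        · rw [min_eq_left h3]; linarith
        · rw [min_eq_right h3, sub_self]; positivity
      have h3 := ih m z' u v' hu hv' h2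
      linarith [conedDist_triangle hA v u v']
  refine ⟨2 * M, by positivity, fun z z' v v' hv hv' => ?_⟩
  have h1 := key ⌈dist z z'⌉₊ z z' v v' hv hv' (Nat.le_ceil _)
  have h2 := (Nat.ceil_lt_add_one (dist_nonneg (x := z) (y := z'))).le
  have h3 : 0 ≤ dist z z' := dist_nonneg
  refine h1.trans ?_
  nlinarith

/-- Coarse convexity of horoballs, from the four-point condition with one point at infinity. -/
lemma horo_le_of_between (S : HoroballSystem H δ R x₀ h) {c : Cone H} {C r : ℝ} {x y m : X}
    (hx : h c x ≤ r) (hy : h c y ≤ r) (hm : Between C x y m) : h c m ≤ r + 2 * δ + C := by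
  have h1 := S.fourPoint_horo c x y m
  unfold Between at hm
  rw [dist_comm y m] at h1
  have h2 : 0 ≤ dist x m := dist_nonneg
  have h3 : 0 ≤ dist m y := dist_nonneg
  rcases le_total (dist x m + h c y) (h c x + dist m y) with h4 | h4
  · rw [max_eq_right h4] at h1
    linarith
  · rw [max_eq_left h4] at h1
    linarith

/-- A point between two points that are close to the same vertex is close to that vertex. -/
lemma exists_conedDist_le_of_between (S : HoroballSystem H δ R x₀ h)
    (hA : Subgroup.closure A = ⊤) :
    ∃ K : ℝ, 0 ≤ K ∧ ∀ C z z' v m w, 0 ≤ C → CloseTo R x₀ h z v → CloseTo R x₀ h z' v →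
      Between C z z' m → CloseTo R x₀ h m w → conedDist H A w v ≤ K * (C + 1) := by
  obtain ⟨M, hM0, hM⟩ := S.exists_conedDist_le_mul hA
  have hR := S.nonneg_R
  have hδ := S.nonneg_δ
  refine ⟨M * (2 + 3 * R + 2 * δ), by positivity, ?_⟩
  rintro C z z' (g | c) m w hC hz hz' hm hw
  · have h1 : dist z (g • x₀) ≤ R := hz
    have h2 : dist z' (g • x₀) ≤ R := hz'
    have h3 := dist_triangle_right z z' (g • x₀)
    unfold Between at hm
    have h4 : 0 ≤ dist m z' := dist_nonneg
    have h5 := dist_triangle m z (g • x₀)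
    rw [dist_comm m z] at h5
    have h6 := hM m (g • x₀) w (.inl g) hw (by simpa [CloseTo] using hR)
    refine h6.trans ?_
    rw [mul_assoc]
    refine mul_le_mul_of_nonneg_left ?_ hM0
    nlinarith
  · have h1 := S.horo_le_of_between (c := c) hz hz' hm
    obtain ⟨p, hp, hp'⟩ := S.descend c m (2 * δ + C) (by positivity)
    have h6 := hM m p w (.inr c) hw (show h c p ≤ R by linarith)
    refine h6.trans ?_
    rw [mul_assoc]
    refine mul_le_mul_of_nonneg_left ?_ hM0
    nlinarith

/-- A point between the ends of a path of at most `2 ^ l` edges is at distance `O(l)` from that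
path. -/
lemma exists_conedDist_le_log (S : HoroballSystem H δ R x₀ h) (hA : Subgroup.closure A = ⊤)
    (hAR : ∀ a ∈ A, dist x₀ (a • x₀) ≤ R) :
    ∃ K : ℝ, 0 ≤ K ∧ ∀ (l : ℕ) (v : ℕ → G ⊕ Cone H) (a b : ℕ) (C : ℝ) (m : X) (w : G ⊕ Cone H),
      a ≤ b → b ≤ a + 2 ^ l → (∀ i, a ≤ i → i < b → (conedOff H A).Adj (v i) (v (i + 1))) →
      0 ≤ C → Between C (vertexPoint H x₀ (v a)) (vertexPoint H x₀ (v b)) m →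
      CloseTo R x₀ h m w →
      ∃ i, a ≤ i ∧ i ≤ b ∧ conedDist H A w (v i) ≤ K * (C + 2 * δ * l + 1) := by
  obtain ⟨K, hK0, hK⟩ := S.exists_conedDist_le_of_between hA
  have hδ := S.nonneg_δ
  refine ⟨K, hK0, fun l v => ?_⟩
  induction l with
  | zero =>
    intro a b C m w hab hba hadj hC hm hw
    rw [pow_zero] at hba
    simp only [Nat.cast_zero, mul_zero, add_zero]
    obtain rfl | rfl : b = a ∨ b = a + 1 := by omega
    · exact ⟨b, le_rfl, le_rfl, hK C _ _ (v b) m w hC (S.closeTo_vertexPoint _)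
        (S.closeTo_vertexPoint _) hm hw⟩
    · obtain ⟨e, he, he1, he2⟩ := S.adj_closeTo hAR (hadj a le_rfl (Nat.lt_succ_self a))
      have := hK C _ _ e m w hC he1 he2 hm hw
      rcases he with rfl | rfl
      · exact ⟨a, le_rfl, hab, this⟩
      · exact ⟨a + 1, hab, le_rfl, this⟩
  | succ l ih =>
    intro a b C m w hab hba hadj hC hm hw
    have hle : K * (C + 2 * δ * l + 1) ≤ K * (C + 2 * δ * (l + 1 : ℕ) + 1) := by
      refine mul_le_mul_of_nonneg_left ?_ hK0
      push_cast
      nlinarith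
    have heq : K * (C + 2 * δ + 2 * δ * l + 1) = K * (C + 2 * δ * (l + 1 : ℕ) + 1) := by
      push_cast
      ring
    by_cases hb : b ≤ a + 2 ^ l
    · obtain ⟨i, hi, hi', h1⟩ := ih a b C m w hab hb hadj hC hm hw
      exact ⟨i, hi, hi', h1.trans hle⟩
    · rw [pow_succ] at hba
      -- Bisect the path: `m` is between the ends of one of the two halves, and each bisection adds
      -- `2 * δ` to the error.
      rcases S.fourPoint.between_or hm (vertexPoint H x₀ (v (a + 2 ^ l))) with h1 | h1
      · obtain ⟨i, hi, hi', h2⟩ := ih a (a + 2 ^ l) (C + 2 * δ) m w (by omega) le_rfl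
          (fun i hi hi' => hadj i hi (by omega)) (by positivity) h1 hw
        exact ⟨i, hi, by omega, heq ▸ h2⟩
      · obtain ⟨i, hi, hi', h2⟩ := ih (a + 2 ^ l) b (C + 2 * δ) m w (by omega) (by omega)
          (fun i hi hi' => hadj i (by omega) hi') (by positivity) h1 hw
        exact ⟨i, by omega, hi', heq ▸ h2⟩

end HoroballSystem

end HoroballSystem

/-- Any linear function of `D` is bounded by `2 ^ l` for some `l` that is small compared with
`D`. -/
lemma exists_forall_le_two_pow {α : ℝ} (hα : 0 ≤ α) (β a b : ℝ) :
    ∃ D₀ : ℝ, ∀ D : ℝ, D₀ ≤ D → ∃ l : ℕ, α * D + β ≤ 2 ^ l ∧ a * l + b ≤ D - 1 := by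
  have h0 : Tendsto (fun l : ℕ => (l : ℝ) ^ 2 / 2 ^ l) atTop (𝓝 0) :=
    tendsto_pow_const_div_const_pow_of_one_lt 2 (by norm_num)
  have h1 : ∀ᶠ l : ℕ in atTop, (4 * α + |β| + 1) * (l : ℝ) ^ 2 ≤ 2 ^ l := by
    have hpos : 0 < 4 * α + |β| + 1 := by positivity
    filter_upwards [h0.eventually_lt_const (inv_pos.2 hpos)] with l hl
    rw [div_lt_iff₀ (by positivity), inv_mul_eq_div, lt_div_iff₀ hpos] at hl
    linarith
  have h2 : ∀ᶠ l : ℕ in atTop, |a| + |b| + 1 ≤ (l : ℝ) :=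
    tendsto_natCast_atTop_atTop.eventually_ge_atTop _
  obtain ⟨N, hN⟩ := (h1.and h2).exists_forall_of_atTop
  -- With `l` about `√D`, the power `2 ^ l` exceeds any multiple of `l ^ 2`, hence of `D`, while `a
  -- * l + b` is only of order `√D`.
  refine ⟨(N : ℝ) ^ 2, fun D hD => ⟨⌊√D⌋₊, ?_⟩⟩
  have hD0 : 0 ≤ D := le_trans (by positivity) hD
  have hl : N ≤ ⌊√D⌋₊ := Nat.le_floor (Real.le_sqrt_of_sq_le hD)
  obtain ⟨h3, h4⟩ := hN _ hl
  set l := ⌊√D⌋₊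
  have h5 : (l : ℝ) ≤ √D := Nat.floor_le (Real.sqrt_nonneg D)
  have h6 : √D < l + 1 := Nat.lt_floor_add_one _
  have h7 : √D ^ 2 = D := Real.sq_sqrt hD0
  have hl0 : (1 : ℝ) ≤ l := by linarith [abs_nonneg a, abs_nonneg b]
  have h8 : D ≤ 4 * (l : ℝ) ^ 2 := by nlinarith [Real.sqrt_nonneg D]
  have h9 : (l : ℝ) ^ 2 ≤ D := by nlinarith
  constructor
  · refine le_trans ?_ h3
    have : β ≤ |β| * (l : ℝ) ^ 2 :=
      (le_abs_self β).trans (le_mul_of_one_le_right (abs_nonneg β) (one_le_pow₀ hl0))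
    nlinarith
  · have h10 : a * l ≤ |a| * l := mul_le_mul_of_nonneg_right (le_abs_self a) (by linarith)
    have h11 : b ≤ |b| * l := by nlinarith [le_abs_self b, abs_nonneg b]
    nlinarith

/-! ### The Morse lemma. -/

section HoroballSystem

variable {G : Type*} [Group G] {k : ℕ}
  {H : Fin k → Subgroup G} {A : Set G} {X : Type*} [MetricSpace X] [MulAction G X]
  {δ R : ℝ} {x₀ : X} {h : Cone H → X → ℝ}

namespace HoroballSystem

/-- Going away from `m`, one meets a point whose image in the coned-off graph is at a prescribed
distance from the image of `m`, up to a bounded error. -/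
lemma exists_between_conedDist (S : HoroballSystem H δ R x₀ h) (hA : Subgroup.closure A = ⊤)
    {M : ℝ} (hM : ∀ z z' v v', CloseTo R x₀ h z v → CloseTo R x₀ h z' v' →
      conedDist H A v v' ≤ M * (1 + dist z z')) (hM0 : 0 ≤ M) {x m : X} {w e : G ⊕ Cone H} {T : ℝ}
    (hw : CloseTo R x₀ h m w) (he : CloseTo R x₀ h x e) (hT : M ≤ T)
    (hwe : T < conedDist H A w e) :
    ∃ z u, Between 0 x m z ∧ CloseTo R x₀ h z u ∧ T < conedDist H A w u ∧
      conedDist H A w u ≤ T + 2 * M := by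
  classical
  obtain ⟨γ, h0, h1, -, hγ, hγ'⟩ := S.geodesic.exists_path m x
  set d := dist m x with hd
  have hd0 : 0 ≤ d := dist_nonneg
  have hmem : ∀ n : ℕ, min (n : ℝ) d ∈ Set.Icc 0 d :=
    fun n => ⟨le_min n.cast_nonneg hd0, min_le_right _ _⟩
  have hex : ∃ n : ℕ, ∃ u, CloseTo R x₀ h (γ (min n d)) u ∧ T < conedDist H A w u := by
    refine ⟨⌈d⌉₊, e, ?_, hwe⟩
    rw [min_eq_right (Nat.le_ceil d), h1]
    exact he
  obtain ⟨u, hu, hu'⟩ := Nat.find_spec hex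
  -- The first unit step at which the distance exceeds `T`. The previous point gave at most `T`, and
  -- one step changes the image by at most `2 * M`.
  set n := Nat.find hex with hn
  have hn0 : n ≠ 0 := by
    intro hn0
    rw [hn0, Nat.cast_zero, min_eq_left hd0, h0] at hu
    have := hM m m w u hw hu
    rw [dist_self] at this
    linarith
  obtain ⟨n', hn'⟩ := Nat.exists_eq_succ_of_ne_zero hn0
  have hmin := Nat.find_min hex (m := n') (by omega)
  push Not at hmin
  obtain ⟨u', hu1⟩ := S.exists_closeTo (γ (min n' d))
  have hu2 := hmin u' hu1
  have h2 : dist (γ (min n' d)) (γ (min n d)) ≤ 1 := by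
    rw [hγ' _ (hmem n') _ (hmem n), hn', Nat.cast_succ, abs_sub_comm, abs_le]
    constructor
    · linarith [min_le_min_right d (show (n' : ℝ) ≤ n' + 1 by linarith)]
    · rcases le_total (n' : ℝ) d with h3 | h3
      · rw [min_eq_left h3]
        linarith [min_le_left ((n' : ℝ) + 1) d]
      · rw [min_eq_right h3]
        linarith [min_le_right ((n' : ℝ) + 1) d]
  have h3 := hM _ _ u' u hu1 hu
  have h4 := conedDist_triangle hA w u' u
  refine ⟨γ (min n d), u, ?_, hu, hu', by nlinarith⟩
  unfold Between
  obtain ⟨h5, h6⟩ := hγ _ (hmem n)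
  rw [dist_comm x, dist_comm _ m, h5, h6, dist_comm x m]
  linarith

/-- The Morse lemma: a point of a geodesic of `X` that joins the ends of a quasigeodesic of the
coned-off graph is within bounded distance of that quasigeodesic, in the coned-off graph. -/
theorem exists_conedDist_le_of_isQuasigeodesicSeq (S : HoroballSystem H δ R x₀ h)
    (hA : Subgroup.closure A = ⊤) (hAR : ∀ a ∈ A, dist x₀ (a • x₀) ≤ R) {P : ℝ} (hP : 0 ≤ P) :
    ∃ D₀ : ℝ, 0 ≤ D₀ ∧ ∀ (v : ℕ → G ⊕ Cone H) (a b : ℕ), a ≤ b →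
      IsQuasigeodesicSeq H A P v a b → ∀ m w,
      Between 0 (vertexPoint H x₀ (v a)) (vertexPoint H x₀ (v b)) m → CloseTo R x₀ h m w →
      ∃ i, a ≤ i ∧ i ≤ b ∧ conedDist H A w (v i) ≤ D₀ := by
  classical
  obtain ⟨M, hM0, hM⟩ := S.exists_conedDist_le_mul hA
  obtain ⟨K, hK0, hK⟩ := S.exists_conedDist_le_of_between hA
  obtain ⟨L, hL0, hL⟩ := S.exists_conedDist_le_log hA hAR
  have hδ := S.nonneg_δ
  -- The linear function dominates both path lengths used below, `2 * D + 2` and `P * (6 * D + 4 *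
  -- M) + P`; the other bound makes the logarithmic estimate at most `D - 1`.
  obtain ⟨D₁, hD₁⟩ := exists_forall_le_two_pow (α := 2 + 6 * P) (by positivity)
    (2 + 4 * P * M + P) (L * (2 * δ)) (L * (6 * δ + 1))
  set D₀ := max 1 (max D₁ (max M (K * (6 * δ + 1)))) with hD₀
  refine ⟨D₀, le_trans zero_le_one (le_max_left _ _), fun v a b hab hv => ?_⟩
  set φ : G ⊕ Cone H → X := vertexPoint H x₀ with hφ
  -- Some bound, depending on the path, exists by the logarithmic estimate. The least one, `D`, is
  -- shown to be at most `D₀`; otherwise minimality yields `m` whose image `w` is farther than `D -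
  -- 1` from the path.
  have hex : ∃ D : ℕ, ∀ m w, Between 0 (φ (v a)) (φ (v b)) m → CloseTo R x₀ h m w →
      ∃ i, a ≤ i ∧ i ≤ b ∧ conedDist H A w (v i) ≤ D := by
    refine ⟨⌈L * (0 + 2 * δ * (b - a : ℕ) + 1)⌉₊, fun m w hm hw => ?_⟩
    obtain ⟨i, hi, hi', h1⟩ := hL (b - a) v a b 0 m w hab
      (by have := (Nat.lt_two_pow_self (n := b - a)).le; omega) hv.adj le_rfl hm hw
    exact ⟨i, hi, hi', h1.trans (Nat.le_ceil _)⟩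
  have hQ := Nat.find_spec hex
  set D := Nat.find hex with hD
  suffices hDD : (D : ℝ) ≤ D₀ by
    intro m w hm hw
    obtain ⟨i, hi, hi', h1⟩ := hQ m w hm hw
    exact ⟨i, hi, hi', h1.trans hDD⟩
  by_contra! hlt
  have h1D : 1 < (D : ℝ) := (le_max_left _ _).trans_lt hlt
  have hD₁D : D₁ ≤ D := ((le_max_of_le_right (le_max_left _ _)).trans_lt hlt).le
  have hMD : M ≤ D :=
    ((le_max_of_le_right (le_max_of_le_right (le_max_left _ _))).trans_lt hlt).le
  have hKD : K * (6 * δ + 1) < D :=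
    (le_max_of_le_right (le_max_of_le_right (le_max_right _ _))).trans_lt hlt
  obtain ⟨l, hl, hl'⟩ := hD₁ D hD₁D
  have hl2 : 2 * (D : ℝ) + 2 ≤ 2 ^ l := by
    nlinarith [mul_nonneg hP hM0, mul_nonneg hP (D.cast_nonneg (α := ℝ))]
  have hl3 : P * (6 * D + 4 * M) + P ≤ 2 ^ l := by linarith
  have hbound : ∀ C, C ≤ 6 * δ → L * (C + 2 * δ * l + 1) ≤ D - 1 := by
    intro C hC
    nlinarith
  have hfind := Nat.find_min hex (m := D - 1) (by
    have : 1 < D := by exact_mod_cast h1D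
    omega)
  push Not at hfind
  obtain ⟨m, w, hm, hw, hfar⟩ := hfind
  have hfar' : ∀ i, a ≤ i → i ≤ b → (D : ℝ) - 1 < conedDist H A w (v i) := by
    intro i hi hi'
    have := hfar i hi hi'
    rwa [Nat.cast_sub (by exact_mod_cast h1D.le), Nat.cast_one] at this
  -- a point `z` on either side of `m`, and a nearby vertex of the path
  have side : ∀ e x, a ≤ e → e ≤ b → x = φ (v e) →
      (∀ z, Between 0 x m z → Between 0 (φ (v a)) (φ (v b)) z) →
      ∃ i z, a ≤ i ∧ i ≤ b ∧ Between 0 x m z ∧ conedDist H A w (v i) ≤ 3 * D + 2 * M ∧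
        ∀ C y, 0 ≤ C → C ≤ 2 * δ → Between C z y m → Between (C + 2 * δ) (φ (v i)) y m := by
    intro e x hae heb hx hxz
    by_cases hwe : conedDist H A w (v e) ≤ 2 * D
    · refine ⟨e, x, hae, heb, between_left _ _, by linarith, fun C y _ _ hy => ?_⟩
      exact hx ▸ hy.mono (by linarith)
    · push Not at hwe
      obtain ⟨z, u, hz, hu, hu1, hu2⟩ := S.exists_between_conedDist hA hM hM0 (x := x) (e := v e)
        hw (hx ▸ S.closeTo_vertexPoint _) (by linarith) hwe
      obtain ⟨i, hai, hib, hi⟩ := hQ z u (hxz z hz) hu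
      refine ⟨i, z, hai, hib, hz, by linarith [conedDist_triangle hA w u (v i)], ?_⟩
      intro C y hC hC' hy
      rcases S.fourPoint.between_or hy (φ (v i)) with h1 | h1
      -- Otherwise `m` is between `z` and `v i`, hence between `z` and `u`, or between `u` and `v
      -- i`, with error at most `6 * δ`. The first puts `w` within `D` of `u`. The second puts `w`
      -- within `D - 1` of an almost geodesic from `u` to `v i`, whose vertices are within `D + 1`
      -- of `u`. Both contradict the choice of `u` farther than `2 * D` from `w`.
      · exfalso
        rcases S.fourPoint.between_or h1 (φ u) with h2 | h2
        · have h3 := hK _ _ _ u m w (by positivity) hu (S.closeTo_vertexPoint u) h2 hw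
          nlinarith
        · obtain ⟨p, -, hp, hp'⟩ := exists_almost_geodesic hA u (v i)
          have hlen : p.length ≤ 2 ^ l := by
            have : (p.length : ℝ) ≤ 2 ^ l := by linarith
            exact_mod_cast this
          obtain ⟨j, -, hj, hj'⟩ := hL l p.getVert 0 p.length (C + 2 * δ + 2 * δ) m w (Nat.zero_le _) (by omega)
            (fun i _ hi => p.adj_getVert_succ hi) (by positivity)
            (by rw [p.getVert_zero, p.getVert_length]; exact h2) hw
          have h3 := hp' j hj
          have h4 := conedDist_nonneg (A := A) (p.getVert j) (v i)
          have h5 := hbound (C + 2 * δ + 2 * δ) (by linarith)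
          have h6 := conedDist_triangle hA w (p.getVert j) u
          rw [conedDist_comm hA (p.getVert j) u] at h6
          linarith
      · exact h1
  obtain ⟨i, z, hai, hib, hz, hwi, hi⟩ := side a _ le_rfl hab rfl fun z hz => hm.trans hz
  obtain ⟨j, z', haj, hjb, hz', hwj, hj⟩ := side b _ hab le_rfl rfl fun z hz =>
    (hm.symm.trans hz).symm
  have h1 := hi 0 z' le_rfl (by positivity) (hm.between_of_between hz hz')
  have h2 := hj _ (φ (v i)) (by positivity) (by linarith) h1.symm
  -- The part of the path from `i` to `j` has at most `2 ^ l` edges by quasigeodesicity, so the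
  -- logarithmic estimate gives a vertex within `D - 1` of `w`.
  have hlast : ∀ i j, a ≤ i → i ≤ j → j ≤ b → conedDist H A w (v i) ≤ 3 * D + 2 * M →
      conedDist H A w (v j) ≤ 3 * D + 2 * M →
      ¬ Between (0 + 2 * δ + 2 * δ) (φ (v i)) (φ (v j)) m := by
    intro i j hai hij hjb hwi hwj hbet
    have h3 := hv.le i j hai hij hjb
    have h4 := conedDist_triangle hA (v i) w (v j)
    rw [conedDist_comm hA (v i) w] at h4
    have h5 : (j : ℝ) ≤ i + 2 ^ l := by nlinarith
    obtain ⟨r, hr, hr', h6⟩ := hL l v i j (0 + 2 * δ + 2 * δ) m w hij (by exact_mod_cast h5)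
      (fun r hr hr' => hv.adj r (hai.trans hr) (hr'.trans_le hjb)) (by positivity) hbet hw
    have h7 := hfar' r (hai.trans hr) (hr'.trans hjb)
    have h8 := hbound (0 + 2 * δ + 2 * δ) (by linarith)
    linarith
  rcases le_total i j with hij | hij
  · exact hlast i j hai hij hjb hwi hwj h2.symm
  · exact hlast j i haj hij hib hwj hwi h2

end HoroballSystem

end HoroballSystem

/-! ### Hyperbolicity of the coned-off graph and bounded coset penetration. -/

section HoroballSystem

variable {G : Type*} [Group G] {k : ℕ}
  {H : Fin k → Subgroup G} {A : Set G} {X : Type*} [MetricSpace X] [MulAction G X]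
  {δ R : ℝ} {x₀ : X} {h : Cone H → X → ℝ}

/-- The distance between the projections of `x` and `y` to the horosphere `h = 0`, if it is
positive and up to a bounded error. -/
def horoProj (h : X → ℝ) (x y : X) : ℝ := dist x y - h x - h y

lemma horoProj_comm (h : X → ℝ) (x y : X) : horoProj h x y = horoProj h y x := by
  rw [horoProj, horoProj, dist_comm]
  ring

namespace HoroballSystem

/-- The vertices on an `X`-geodesic lie on a coned-off geodesic, up to a bounded error. -/
lemma exists_conedDist_add_le (S : HoroballSystem H δ R x₀ h)
    (hA : Subgroup.closure A = ⊤) (hAR : ∀ a ∈ A, dist x₀ (a • x₀) ≤ R) :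
    ∃ C : ℝ, 0 ≤ C ∧ ∀ (x y : G ⊕ Cone H) m w,
      Between (2 * δ) (vertexPoint H x₀ x) (vertexPoint H x₀ y) m → CloseTo R x₀ h m w →
      conedDist H A x w + conedDist H A w y ≤ conedDist H A x y + C := by
  obtain ⟨M, hM0, hM⟩ := S.exists_conedDist_le_mul hA
  obtain ⟨D, hD0, hD⟩ := S.exists_conedDist_le_of_isQuasigeodesicSeq hA hAR zero_le_two
  have hδ := S.nonneg_δ
  refine ⟨1 + 2 * (M * (1 + 4 * δ) + D), by positivity, fun x y m w hm hw => ?_⟩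
  set x' := vertexPoint H x₀ x with hx'
  set y' := vertexPoint H x₀ y with hy'
  -- Replace `m` by a nearby point exactly between the ends, as the Morse lemma requires.
  obtain ⟨m', hm1, hm2⟩ := S.geodesic.exists_dist_eq x' y' (t := min (dist x' m) (dist x' y'))
    (le_min dist_nonneg dist_nonneg) (min_le_right _ _)
  have hmm : dist m m' ≤ 4 * δ := by
    have h1 := S.fourPoint x' y' m m'
    rw [dist_comm y' m', dist_comm y' m] at h1
    unfold Between at hm
    have h2 : 0 ≤ dist m y' := dist_nonneg
    rcases le_total (dist x' m) (dist x' y') with h3 | h3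
    · rw [min_eq_left h3] at hm1 hm2
      rcases max_cases (dist x' m + dist m' y') (dist x' m' + dist m y') with h4 | h4 <;>
      linarith
    · rw [min_eq_right h3] at hm1 hm2
      rcases max_cases (dist x' m + dist m' y') (dist x' m' + dist m y') with h4 | h4 <;>
      linarith
  have hbet : Between 0 x' y' m' := by
    unfold Between
    linarith
  obtain ⟨w', hw'⟩ := S.exists_closeTo m'
  have hww : conedDist H A w w' ≤ M * (1 + 4 * δ) :=
    (hM m m' w w' hw hw').trans (by gcongr)
  obtain ⟨p, hp, -, hp'⟩ := exists_almost_geodesic hA x y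
  have hseq := hp.seq
  rw [mul_one] at hseq
  obtain ⟨i, -, hi, h1⟩ := hD p.getVert 0 p.length (Nat.zero_le _) hseq m' w'
    (by rw [p.getVert_zero, p.getVert_length]; exact hbet) hw'
  have h2 := hp' i hi
  have h3 := conedDist_triangle hA w w' (p.getVert i)
  have h4 := conedDist_triangle hA w (p.getVert i) y
  have h5 := conedDist_triangle hA x (p.getVert i) w
  rw [conedDist_comm hA (p.getVert i) w] at h5
  linarith

/-- The coned-off graph is hyperbolic. -/
theorem gromovHyperbolic_conedDist (S : HoroballSystem H δ R x₀ h)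
    (hA : Subgroup.closure A = ⊤) (hAR : ∀ a ∈ A, dist x₀ (a • x₀) ≤ R) :
    GromovHyperbolic (conedDist H A) := by
  obtain ⟨C, hC0, hC⟩ := S.exists_conedDist_add_le hA hAR
  refine ⟨C, hC0, fun x y z w => ?_⟩
  set φ := vertexPoint H x₀
  have hδ := S.nonneg_δ
  obtain ⟨γ, h0, h1, hcont, hγ, -⟩ := S.geodesic.exists_path (φ x) (φ y)
  set d := dist (φ x) (φ y) with hd
  have hbet : ∀ t ∈ Set.Icc 0 d, Between 0 (φ x) (φ y) (γ t) := by
    intro t ht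
    unfold Between
    rw [(hγ t ht).1, (hγ t ht).2]
    linarith
  have hclosed : ∀ p q : X, ∃ u : Set ℝ, IsClosed u ∧
      {t | Between (2 * δ) p q (γ t)} ∩ Set.Icc 0 d = u ∩ Set.Icc 0 d := by
    intro p q
    have hcl : IsClosed {m : X | Between (2 * δ) p q m} := by
      unfold Between
      exact isClosed_le (by fun_prop) (by fun_prop)
    obtain ⟨u, hu, hu'⟩ := continuousOn_iff_isClosed.1 hcont _ hcl
    exact ⟨u, hu, hu'⟩
  suffices hmain : ∃ t ∈ Set.Icc 0 d,
      (Between (2 * δ) (φ x) (φ z) (γ t) ∧ Between (2 * δ) (φ w) (φ y) (γ t)) ∨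
      (Between (2 * δ) (φ z) (φ y) (γ t) ∧ Between (2 * δ) (φ x) (φ w) (γ t)) by
    obtain ⟨t, ht, hor⟩ := hmain
    obtain ⟨u, hu⟩ := S.exists_closeTo (γ t)
    have h3 := conedDist_triangle hA x u y
    have h4 := conedDist_triangle hA z u w
    have hcomm : ∀ a b, conedDist H A a b = conedDist H A b a := conedDist_comm hA
    rcases hor with ⟨h5, h6⟩ | ⟨h5, h6⟩
    · have h7 := hC x z (γ t) u h5 hu
      have h8 := hC w y (γ t) u h6 hu
      rw [hcomm w y, hcomm w u] at h8
      rw [hcomm z u] at h4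
      linarith [le_max_left (conedDist H A x z + conedDist H A y w)
        (conedDist H A x w + conedDist H A y z)]
    · have h7 := hC z y (γ t) u h5 hu
      have h8 := hC x w (γ t) u h6 hu
      rw [hcomm z y] at h7
      linarith [le_max_right (conedDist H A x z + conedDist H A y w)
        (conedDist H A x w + conedDist H A y z)]
  -- Each point of the geodesic is near a side at `z` and a side at `w`. If no point gives a mixed
  -- pair, the interval is covered by two closed sets, near both sides at `x` or near both sides at
  -- `y`. By connectedness they meet, and a common point gives a mixed pair.
  by_contra! hnone
  obtain ⟨u₁, hu₁, hu₁'⟩ := hclosed (φ x) (φ z)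
  obtain ⟨u₂, hu₂, hu₂'⟩ := hclosed (φ x) (φ w)
  obtain ⟨v₁, hv₁, hv₁'⟩ := hclosed (φ z) (φ y)
  obtain ⟨v₂, hv₂, hv₂'⟩ := hclosed (φ w) (φ y)
  have hmem : ∀ {p q : X} {u : Set ℝ},
      {t | Between (2 * δ) p q (γ t)} ∩ Set.Icc 0 d = u ∩ Set.Icc 0 d →
      ∀ t ∈ Set.Icc 0 d, (t ∈ u ↔ Between (2 * δ) p q (γ t)) := by
    intro p q u hpq t ht
    have := Set.ext_iff.1 hpq t
    simp only [Set.mem_inter_iff, Set.mem_ofPred_eq, ht, and_true] at this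
    exact this.symm
  have hd0 : (0 : ℝ) ∈ Set.Icc 0 d := ⟨le_rfl, dist_nonneg⟩
  have hdd : d ∈ Set.Icc 0 d := ⟨dist_nonneg, le_rfl⟩
  obtain ⟨t, ht, ⟨ht1, -⟩, -, ht2⟩ := isPreconnected_closed_iff.1 (isPreconnected_Icc (a := 0)
    (b := d)) (u₁ ∩ u₂) (v₁ ∩ v₂) (hu₁.inter hu₂) (hv₁.inter hv₂) (by
      intro t ht
      have h3 := S.fourPoint.between_or (hbet t ht) (φ z)
      have h4 := S.fourPoint.between_or (hbet t ht) (φ w)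
      rw [zero_add] at h3 h4
      have h5 := hnone t ht
      simp only [Set.mem_union, Set.mem_inter_iff, hmem hu₁' t ht, hmem hu₂' t ht,
        hmem hv₁' t ht, hmem hv₂' t ht]
      tauto)
    ⟨0, hd0, (hmem hu₁' 0 hd0).2 (h0 ▸ (between_left _ _).mono (by positivity)),
      (hmem hu₂' 0 hd0).2 (h0 ▸ (between_left _ _).mono (by positivity))⟩
    ⟨d, hdd, (hmem hv₁' d hdd).2 (h1 ▸ (between_right _ _).mono (by positivity)),
      (hmem hv₂' d hdd).2 (h1 ▸ (between_right _ _).mono (by positivity))⟩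
  exact (hnone t ht).1 ((hmem hu₁' t ht).1 ht1) ((hmem hv₂' t ht).1 ht2)

/-- `-horoProj / 2` plays the role of a Gromov product based at the parabolic point; this is its
hyperbolicity inequality. -/
lemma horoProj_le_max (S : HoroballSystem H δ R x₀ h) (c : Cone H) (x y z : X) :
    horoProj (h c) x z ≤ max (horoProj (h c) x y) (horoProj (h c) y z) + 2 * δ := by
  have h1 := S.fourPoint_horo c x z y
  unfold horoProj
  rw [dist_comm z y] at h1
  rcases max_cases (dist x y + h c z) (h c x + dist y z) with h2 | h2
  · linarith [le_max_left (dist x y - h c x - h c y) (dist y z - h c y - h c z)]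
  · linarith [le_max_right (dist x y - h c x - h c y) (dist y z - h c y - h c z)]

/-- The geodesic between points whose projections to a horosphere are far apart enters the
horoball. -/
lemma exists_between_horo_le (S : HoroballSystem H δ R x₀ h) (c : Cone H) (x y : X) :
    ∃ m, Between 0 x y m ∧ h c m ≤ -(horoProj (h c) x y) / 2 + 2 * δ := by
  have h1 := S.lipschitz c x y
  have h2 := S.lipschitz c y x
  rw [dist_comm y x] at h2
  -- The point at which the two terms of the maximum in `fourPoint_horo` coincide.
  obtain ⟨m, hm, hm'⟩ := S.geodesic.exists_dist_eq x y (t := (dist x y + h c x - h c y) / 2)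
    (by linarith) (by linarith)
  refine ⟨m, by unfold Between; linarith, ?_⟩
  have h3 := S.fourPoint_horo c x y m
  rw [dist_comm y m] at h3
  unfold horoProj
  rcases max_cases (dist x m + h c y) (h c x + dist m y) with h4 | h4 <;> linarith

/-- The projection of another horoball to a horosphere is bounded. -/
lemma horoProj_le_of_ne (S : HoroballSystem H δ R x₀ h) {c c' : Cone H} (hc : c' ≠ c) {x y : X}
    (hx : h c' x ≤ R) (hy : h c' y ≤ R) : horoProj (h c) x y ≤ 2 * (R + 4 * δ + 1) := by
  obtain ⟨m, hm, hm'⟩ := S.exists_between_horo_le c x y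
  have h1 := S.horo_le_of_between hx hy hm
  have hR := S.nonneg_R
  have hδ := S.nonneg_δ
  -- `p` lies in the horoball of `c'`, hence outside that of `c`, so `m` cannot be deep in the
  -- latter.
  obtain ⟨p, hp, hp'⟩ := S.descend c' m (R + 2 * δ) (by positivity)
  have h2 : 0 < h c p := by
    by_contra! hcon
    exact hc (S.disjoint c' c p (by linarith) hcon)
  have h3 := S.lipschitz c p m
  rw [dist_comm p m] at h3
  linarith

/-- The projection to the horosphere of `c` moves by a bounded amount along an edge that does
not contain the vertex `c`. -/
lemma horoProj_le_of_adj (S : HoroballSystem H δ R x₀ h)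
    (hAR : ∀ a ∈ A, dist x₀ (a • x₀) ≤ R) {c : Cone H} {v v' : G ⊕ Cone H}
    (hv : (conedOff H A).Adj v v') (hvc : v ≠ .inr c) (hvc' : v' ≠ .inr c) :
    horoProj (h c) (vertexPoint H x₀ v) (vertexPoint H x₀ v') ≤ 4 * R + 8 * δ + 2 := by
  obtain ⟨e, he, he1, he2⟩ := S.adj_closeTo hAR hv
  have hec : e ≠ .inr c := by
    rcases he with rfl | rfl <;> assumption
  have hR := S.nonneg_R
  have hδ := S.nonneg_δ
  rcases e with g | c'
  · have h1 : dist (vertexPoint H x₀ v) (g • x₀) ≤ R := he1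
    have h2 : dist (vertexPoint H x₀ v') (g • x₀) ≤ R := he2
    have h3 := dist_triangle_right (vertexPoint H x₀ v) (vertexPoint H x₀ v') (g • x₀)
    have h4 := S.lower_vertexPoint c v
    have h5 := S.lower_vertexPoint c v'
    unfold horoProj
    linarith
  · have := S.horoProj_le_of_ne (c := c) (c' := c') (fun h' => hec (h' ▸ rfl)) he1 he2
    linarith

/-- One application of `horoProj_le_max` per edge. The bound grows with `n` and serves only for the
boundedly long part of a quasigeodesic between two visits near `c`. -/
lemma horoProj_le_of_path (S : HoroballSystem H δ R x₀ h)
    (hAR : ∀ a ∈ A, dist x₀ (a • x₀) ≤ R) {c : Cone H} {v : ℕ → G ⊕ Cone H} {a : ℕ} (n : ℕ)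
    (hv : ∀ i, a ≤ i → i < a + n → (conedOff H A).Adj (v i) (v (i + 1)))
    (hvc : ∀ i, a ≤ i → i ≤ a + n → v i ≠ .inr c) :
    horoProj (h c) (vertexPoint H x₀ (v a)) (vertexPoint H x₀ (v (a + n))) ≤
      4 * R + 8 * δ + 2 + 2 * δ * n := by
  have hR := S.nonneg_R
  have hδ := S.nonneg_δ
  induction n with
  | zero =>
    have h4 := S.lower_vertexPoint c (v a)
    rw [add_zero, horoProj, dist_self, Nat.cast_zero]
    linarith
  | succ n ih =>
    have h1 := ih (fun i hi hi' => hv i hi (by omega)) fun i hi hi' => hvc i hi (by omega)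
    have h2 := S.horoProj_le_of_adj hAR (hv (a + n) (by omega) (by omega))
      (hvc _ (by omega) (by omega)) (hvc (a + n + 1) (by omega) (by omega))
    have h3 := S.horoProj_le_max c (vertexPoint H x₀ (v a)) (vertexPoint H x₀ (v (a + n)))
      (vertexPoint H x₀ (v (a + n + 1)))
    have h4 : 0 ≤ 2 * δ * n := by positivity
    rw [← add_assoc]
    push_cast
    refine h3.trans ?_
    rcases max_cases (horoProj (h c) (vertexPoint H x₀ (v a)) (vertexPoint H x₀ (v (a + n))))
      (horoProj (h c) (vertexPoint H x₀ (v (a + n))) (vertexPoint H x₀ (v (a + n + 1))))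
      with h5 | h5 <;> linarith

/-- The projection to the horosphere of `c` of a quasigeodesic that does not pass through the
vertex `c` is bounded. -/
theorem exists_horoProj_le (S : HoroballSystem H δ R x₀ h) (hA : Subgroup.closure A = ⊤)
    (hAR : ∀ a ∈ A, dist x₀ (a • x₀) ≤ R) {P : ℝ} (hP : 0 ≤ P) :
    ∃ C : ℝ, ∀ (c : Cone H) (v : ℕ → G ⊕ Cone H) (a b : ℕ), a ≤ b →
      IsQuasigeodesicSeq H A P v a b → (∀ i, a ≤ i → i ≤ b → v i ≠ .inr c) →
      horoProj (h c) (vertexPoint H x₀ (v a)) (vertexPoint H x₀ (v b)) ≤ C := by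
  classical
  obtain ⟨D, hD0, hD⟩ := S.exists_conedDist_le_of_isQuasigeodesicSeq hA hAR hP
  have hR := S.nonneg_R
  have hδ := S.nonneg_δ
  set E := 4 * R + 8 * δ + 2 with hE
  set F := E + 2 * δ * (P * (2 * D) + P) with hF
  have hEF : E ≤ F := le_add_of_nonneg_right (by positivity)
  refine ⟨F + 6 * δ, fun c v a b hab hv hvc => ?_⟩
  set φ := vertexPoint H x₀
  have far : ∀ i j, a ≤ i → i ≤ j → j ≤ b →
      (∀ l, i ≤ l → l ≤ j → D < conedDist H A (.inr c) (v l)) →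
      horoProj (h c) (φ (v i)) (φ (v j)) ≤ E := by
    intro i j hi hij hj hfar
    by_contra! hlt
    obtain ⟨m, hm, hm'⟩ := S.exists_between_horo_le c (φ (v i)) (φ (v j))
    obtain ⟨l, hl, hl', h1⟩ := hD v i j hij (hv.mono hi hj) m (.inr c) hm
      (show h c m ≤ R by linarith)
    exact (hfar l hl hl').not_ge h1
  have near : ∀ i j, a ≤ i → i ≤ j → j ≤ b → conedDist H A (.inr c) (v i) ≤ D →
      conedDist H A (.inr c) (v j) ≤ D → horoProj (h c) (φ (v i)) (φ (v j)) ≤ F := by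
    intro i j hi hij hj hDi hDj
    obtain ⟨n, rfl⟩ := Nat.exists_eq_add_of_le hij
    have h1 := S.horoProj_le_of_path hAR (c := c) (v := v) (a := i) n
      (fun l hl hl' => hv.adj l (by omega) (by omega)) fun l hl hl' => hvc l (by omega) (by omega)
    have h2 := hv.le i (i + n) hi hij hj
    have h3 := conedDist_triangle hA (v i) (.inr c) (v (i + n))
    rw [conedDist_comm hA (v i) (.inr c)] at h3
    push_cast at h2
    have h4 : (n : ℝ) ≤ P * (2 * D) + P := by nlinarith
    have h5 := mul_le_mul_of_nonneg_left h4 (show 0 ≤ 2 * δ by positivity)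
    linarith
  have step : ∀ i, a ≤ i → i < b → horoProj (h c) (φ (v i)) (φ (v (i + 1))) ≤ E :=
    fun i hi hi' => S.horoProj_le_of_adj hAR (hv.adj i hi hi') (hvc i hi hi'.le)
      (hvc (i + 1) (by omega) (by omega))
  have self : ∀ i, horoProj (h c) (φ (v i)) (φ (v i)) ≤ E := by
    intro i
    have h4 := S.lower_vertexPoint c (v i)
    rw [horoProj, dist_self]
    linarith
  by_cases hall : ∀ l, a ≤ l → l ≤ b → D < conedDist H A (.inr c) (v l)
  · exact (far a b le_rfl hab le_rfl hall).trans (by linarith)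
  push Not at hall
  -- Cut the path at its first and last vertices near `c`: the outer parts are handled by `far` and
  -- one more edge, the middle part by `near`.
  set I := (Finset.Icc a b).filter fun l => conedDist H A (.inr c) (v l) ≤ D with hI
  have hmemI : ∀ l, l ∈ I ↔ (a ≤ l ∧ l ≤ b) ∧ conedDist H A (.inr c) (v l) ≤ D := by
    intro l
    rw [hI, Finset.mem_filter, Finset.mem_Icc]
  have hne : I.Nonempty := by
    obtain ⟨l, hl, hl', h1⟩ := hall
    exact ⟨l, (hmemI l).2 ⟨⟨hl, hl'⟩, h1⟩⟩
  obtain ⟨⟨hai, hib⟩, hDi⟩ := (hmemI _).1 (I.min'_mem hne)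
  obtain ⟨⟨haj, hjb⟩, hDj⟩ := (hmemI _).1 (I.max'_mem hne)
  have hij := I.min'_le_max' hne
  have hmin := fun l hl => I.min'_le l hl
  have hmax := fun l hl => I.le_max' l hl
  set i := I.min' hne
  set j := I.max' hne
  have h1 : horoProj (h c) (φ (v a)) (φ (v i)) ≤ E + 2 * δ := by
    rcases hai.eq_or_lt with h2 | h2
    · rw [← h2]
      linarith [self a]
    · have h3 := far a (i - 1) le_rfl (by omega) (by omega) fun l hl hl' => by
        by_contra! hcon
        have := hmin l ((hmemI l).2 ⟨⟨hl, by omega⟩, hcon⟩)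
        omega
      have h4 := step (i - 1) (by omega) (by omega)
      rw [Nat.sub_add_cancel (by omega)] at h4
      exact (S.horoProj_le_max c _ _ _).trans (by gcongr; exact max_le h3 h4)
  have h2 : horoProj (h c) (φ (v j)) (φ (v b)) ≤ E + 2 * δ := by
    rcases hjb.eq_or_lt with h2 | h2
    · rw [h2]
      linarith [self b]
    · have h3 := far (j + 1) b (by omega) (by omega) le_rfl fun l hl hl' => by
        by_contra! hcon
        have := hmax l ((hmemI l).2 ⟨⟨by omega, hl'⟩, hcon⟩)
        omega
      have h4 := step j (by omega) (by omega)
      exact (S.horoProj_le_max c _ _ _).trans (by gcongr; exact max_le h4 h3)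
  have h3 := near i j hai hij hjb hDi hDj
  have h4 := S.horoProj_le_max c (φ (v a)) (φ (v i)) (φ (v j))
  have h5 := S.horoProj_le_max c (φ (v a)) (φ (v j)) (φ (v b))
  have h6 := max_le (h1.trans (by linarith : E + 2 * δ ≤ F + 2 * δ))
    (h3.trans (by linarith : F ≤ F + 2 * δ))
  have h7 := max_le (h4.trans (by linarith : _ ≤ F + 4 * δ))
    (h2.trans (by linarith : E + 2 * δ ≤ F + 4 * δ))
  linarith

/-- Without backtracking, the parts before entry and after exit miss the cone vertex, so entry and
exit points project near the initial and final points of the path. A second path with the same ends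
either misses the coset or has its own entry and exit points with the same projections. -/
theorem boundedCosetPenetration (S : HoroballSystem H δ R x₀ h) (hA : Subgroup.closure A = ⊤)
    (hAR : ∀ a ∈ A, dist x₀ (a • x₀) ≤ R) : BoundedCosetPenetration H A := by
  intro P hP
  obtain ⟨C, hC⟩ := S.exists_horoProj_le hA hAR (P := 2 * P) (by linarith)
  have hR := S.nonneg_R
  have hδ := S.nonneg_δ
  obtain ⟨M, hM⟩ := S.exists_cayley_dist_le hA (C + 4 * δ + 2 * R)
  have key : ∀ (c : Cone H) {x y : G} (p : (conedOff H A).Walk (.inl x) (.inl y)),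
      IsQuasigeodesic P p → (∀ i ≤ p.length, p.getVert i ≠ .inr c) →
      horoProj (h c) (x • x₀) (y • x₀) ≤ C := by
    intro c x y p hp hpc
    have := hC c p.getVert 0 p.length (Nat.zero_le _) hp.seq fun i _ hi => hpc i hi
    rwa [p.getVert_zero, p.getVert_length] at this
  have hdist : ∀ (c : Cone H) (a b : G), (conedOff H A).Adj (.inl a) (.inr c) →
      (conedOff H A).Adj (.inl b) (.inr c) →
      horoProj (h c) (a • x₀) (b • x₀) ≤ C + 4 * δ →
      ((SimpleGraph.mulCayley A).dist a b : ℝ) ≤ M := by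
    intro c a b ha hb hab
    have h1 := S.upper c a ha
    have h2 := S.upper c b hb
    unfold horoProj at hab
    obtain ⟨w, hw⟩ := hM a b (by linarith)
    exact le_trans (by exact_mod_cast SimpleGraph.dist_le w) hw
  have split : ∀ {x y : G} (p : (conedOff H A).Walk (.inl x) (.inl y)), IsQuasigeodesic P p →
      WithoutBacktracking p → ∀ (c : Cone H) (a b : G), PenetratesFromTo p c a b →
      (conedOff H A).Adj (.inl a) (.inr c) ∧ (conedOff H A).Adj (.inl b) (.inr c) ∧
      horoProj (h c) (x • x₀) (a • x₀) ≤ C ∧ horoProj (h c) (b • x₀) (y • x₀) ≤ C := by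
    rintro x y p hp hpb c a b ⟨q, h₁, h₂, r, rfl⟩
    set p := q.append (.cons h₁ (.cons h₂ r)) with hpdef
    have hlen : p.length = q.length + (r.length + 1 + 1) := by
      simp [hpdef, SimpleGraph.Walk.length_append]
    have hq : ∀ i ≤ q.length, p.getVert i = q.getVert i := by
      intro i hi
      rw [hpdef, SimpleGraph.Walk.getVert_append]
      split_ifs with h3
      · rfl
      · obtain rfl : i = q.length := by omega
        simp
    have hr : ∀ i, p.getVert (q.length + (i + 1)) =
        (SimpleGraph.Walk.cons h₂ r).getVert i := by
      intro i
      rw [hpdef, SimpleGraph.Walk.getVert_append, if_neg (by omega), Nat.add_sub_cancel_left,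
        SimpleGraph.Walk.getVert_cons_succ]
    have hc : p.getVert (q.length + (0 + 1)) = .inr c := hr 0
    refine ⟨h₁, h₂.symm, key c q (hp.subwalk ⟨.nil, _, rfl⟩) ?_,
      key c r (hp.subwalk ⟨q.append (.cons h₁ (.cons h₂ .nil)), .nil, ?_⟩) ?_⟩
    · intro i hi hic
      have := hpb c i (q.length + (0 + 1)) (by omega) (by omega) ((hq i hi).trans hic) hc
      omega
    · rw [hpdef, SimpleGraph.Walk.append_nil, ← SimpleGraph.Walk.append_assoc]
      rfl
    · intro i hi hic
      have h3 : p.getVert (q.length + (i + 1 + 1)) = .inr c := by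
        rw [hr, SimpleGraph.Walk.getVert_cons_succ, hic]
      have := hpb c (q.length + (i + 1 + 1)) (q.length + (0 + 1)) (by omega) (by omega) h3 hc
      omega
  refine ⟨M, fun x y u v p q _ _ hp hq hpb hqb c a b hpab => ?_⟩
  obtain ⟨ha, hb, hxa, hby⟩ := split p hp hpb c a b hpab
  refine ⟨fun hqc => ?_, fun a' b' hq' => ?_⟩
  · have h1 := key c q hq fun i hi hic => hqc (by
      rw [Penetrates, ← hic]
      exact q.getVert_mem_support i)
    have h2 := S.horoProj_le_max c (a • x₀) (x • x₀) (y • x₀)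
    have h3 := S.horoProj_le_max c (a • x₀) (y • x₀) (b • x₀)
    rw [horoProj_comm _ (a • x₀) (x • x₀)] at h2
    rw [horoProj_comm _ (y • x₀) (b • x₀)] at h3
    refine hdist c a b ha hb ?_
    have h4 := max_le hxa h1
    have h5 := max_le (h2.trans (by linarith : _ ≤ C + 2 * δ))
      (hby.trans (by linarith : C ≤ C + 2 * δ))
    linarith
  · obtain ⟨ha', hb', hxa', hby'⟩ := split q hq hqb c a' b' hq'
    constructor
    · refine hdist c a a' ha ha' ?_
      have h2 := S.horoProj_le_max c (a • x₀) (x • x₀) (a' • x₀)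
      rw [horoProj_comm _ (a • x₀) (x • x₀)] at h2
      linarith [max_le hxa hxa']
    · refine hdist c b b' hb hb' ?_
      have h2 := S.horoProj_le_max c (b • x₀) (y • x₀) (b' • x₀)
      rw [horoProj_comm _ (y • x₀) (b' • x₀)] at h2
      linarith [max_le hby hby']

end HoroballSystem

end HoroballSystem

/-! ### Proper geodesic spaces, horofunctions and endpoints of rays. -/

section MetricGeometry

variable {X : Type*} [MetricSpace X]

/-- The Hopf–Rinow theorem for geodesic spaces. -/
theorem IsGeodesicSpace.properSpace [CompleteSpace X] [LocallyCompactSpace X]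
    (hX : IsGeodesicSpace X) : ProperSpace X := by
  refine ⟨fun x => ?_⟩
  have hpt : ∀ (s ε : ℝ), 0 ≤ s → 0 ≤ ε → ∀ y ∈ Metric.closedBall x (s + ε),
      ∃ m ∈ Metric.closedBall x s, dist m y ≤ ε := by
    intro s ε hs hε y hy
    rw [Metric.mem_closedBall, dist_comm] at hy
    obtain ⟨m, hm, hm'⟩ := hX.exists_dist_eq x y (t := min s (dist x y))
      (le_min hs dist_nonneg) (min_le_right _ _)
    refine ⟨m, ?_, ?_⟩
    · rw [Metric.mem_closedBall, dist_comm, hm]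
      exact min_le_left _ _
    · rw [hm']
      rcases le_total s (dist x y) with h | h
      · rw [min_eq_left h]
        linarith
      · rw [min_eq_right h]
        linarith
  set T : Set ℝ := {r | IsCompact (Metric.closedBall x r)} with hT
  have hmono : ∀ r s, r ≤ s → s ∈ T → r ∈ T := fun r s hrs hs =>
    IsCompact.of_isClosed_subset hs Metric.isClosed_closedBall
      (Metric.closedBall_subset_closedBall hrs)
  have h0 : (0 : ℝ) ∈ T := by simp [hT]
  by_contra! hcon
  obtain ⟨r₀, hr₀⟩ := hcon
  have hbdd : BddAbove T := ⟨r₀, fun r hr => by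
    by_contra! hlt
    exact hr₀ (hmono _ _ hlt.le hr)⟩
  set s := sSup T with hs
  have hs0 : 0 ≤ s := le_csSup hbdd h0
  have hlt : ∀ r < s, r ∈ T := by
    intro r hr
    obtain ⟨r', hr', hrr'⟩ := exists_lt_of_lt_csSup ⟨0, h0⟩ hr
    exact hmono _ _ hrr'.le hr'
  -- The supremum is attained because the ball of radius `s` is within `ε / 2` of a smaller compact
  -- ball; local compactness then enlarges the radius past `s`.
  have hsT : s ∈ T := by
    refine TotallyBounded.isCompact_of_isClosed (Metric.totallyBounded_iff.2 fun ε hε => ?_)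
      Metric.isClosed_closedBall
    rcases hs0.eq_or_lt with h | h
    · refine ⟨{x}, Set.finite_singleton x, ?_⟩
      rw [← h, Metric.closedBall_zero]
      simpa using hε
    · set r := max 0 (s - ε / 2) with hr
      have hrs : r < s := max_lt h (by linarith)
      obtain ⟨t, -, ht, htc⟩ := IsCompact.finite_cover_balls (hlt r hrs) (half_pos hε)
      refine ⟨t, ht, fun y hy => ?_⟩
      obtain ⟨m, hm, hmy⟩ := hpt r (ε / 2) (le_max_left _ _) (half_pos hε).le y
        (Metric.closedBall_subset_closedBall (by linarith [le_max_right 0 (s - ε / 2)]) hy)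
      obtain ⟨z, hz, hmz⟩ := Set.mem_iUnion₂.1 (htc hm)
      refine Set.mem_iUnion₂.2 ⟨z, hz, ?_⟩
      rw [Metric.mem_ball] at hmz ⊢
      have := dist_triangle_left y z m
      linarith
  obtain ⟨K, hK, hsK⟩ := exists_compact_superset (show IsCompact (Metric.closedBall x s) from hsT)
  obtain ⟨ε, hε, hεK⟩ := IsCompact.exists_cthickening_subset_open
    (show IsCompact (Metric.closedBall x s) from hsT) isOpen_interior hsK
  have : s + ε ∈ T := by
    refine IsCompact.of_isClosed_subset hK Metric.isClosed_closedBall fun y hy => ?_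
    obtain ⟨m, hm, hmy⟩ := hpt s ε hs0 hε.le y hy
    exact interior_subset (hεK (Metric.mem_cthickening_of_dist_le y m ε _ hm
      (by rwa [dist_comm])))
  linarith [le_csSup hbdd this]

variable {γ η : ℝ≥0 → X}

lemma dist_ray (hγ : Isometry γ) {s t : ℝ≥0} (hst : s ≤ t) :
    dist (γ s) (γ t) = (t : ℝ) - s := by
  rw [hγ.dist_eq, NNReal.dist_eq, abs_sub_comm,
    abs_of_nonneg (sub_nonneg.2 (NNReal.coe_le_coe.2 hst))]

lemma horofunction_le (hγ : Isometry γ) (x : X) (t : ℝ≥0) :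
    horofunction γ x ≤ dist x (γ t) - t := by
  refine le_of_tendsto (tendsto_horofunction hγ x) ?_
  filter_upwards [eventually_ge_atTop t] with u hu
  have := dist_triangle x (γ t) (γ u)
  rw [dist_ray hγ hu] at this
  linarith

lemma horofunction_ray_le (hγ : Isometry γ) (t : ℝ≥0) : horofunction γ (γ t) ≤ -(t : ℝ) := by
  simpa using horofunction_le hγ (γ t) t

lemma horofunction_le_add_dist (hγ : Isometry γ) (x y : X) :
    horofunction γ x ≤ horofunction γ y + dist x y := by
  refine le_of_tendsto_of_tendsto' (tendsto_horofunction hγ x)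
    ((tendsto_horofunction hγ y).add_const _) fun t => ?_
  linarith [dist_triangle x y (γ t)]

lemma continuous_horofunction (hγ : Isometry γ) : Continuous (horofunction γ) :=
  LipschitzWith.continuous (K := 1)
    (LipschitzWith.of_le_add fun x y => horofunction_le_add_dist hγ x y)

lemma FourPoint.add_horofunction_le {δ : ℝ} (hδ : FourPoint X δ) (hγ : Isometry γ) (x y z : X) :
    dist x y + horofunction γ z ≤
      max (dist x z + horofunction γ y) (horofunction γ x + dist y z) + 2 * δ := by
  have hz := (tendsto_horofunction hγ z).const_add (dist x y)
  have hy := (tendsto_horofunction hγ y).const_add (dist x z)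
  have hx := (tendsto_horofunction hγ x).add_const (dist y z)
  refine le_of_tendsto_of_tendsto' hz ((hy.max hx).add_const _) fun t => ?_
  have h1 := hδ x y z (γ t)
  have h2 : max (dist x z + (dist y (γ t) - t)) (dist x (γ t) - t + dist y z) =
      max (dist x z + dist y (γ t)) (dist x (γ t) + dist y z) - t := by
    rw [← max_sub_sub_right]
    congr 1 <;> ring
  rw [h2]
  linarith

lemma IsGeodesicSpace.exists_horofunction_le (hX : IsGeodesicSpace X) (hγ : Isometry γ) (x : X)
    {s : ℝ} (hs : 0 ≤ s) :
    ∃ p, dist x p ≤ s + 1 ∧ horofunction γ p ≤ horofunction γ x - s := by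
  have h1 := (tendsto_horofunction hγ x).eventually_lt_const
    (lt_add_one (horofunction γ x))
  have h2 : ∀ᶠ t : ℝ≥0 in atTop, s + 1 - horofunction γ x ≤ t :=
    (NNReal.tendsto_coe_atTop.2 tendsto_id).eventually_ge_atTop _
  obtain ⟨t, ht, ht'⟩ := (h1.and h2).exists
  have h3 := horofunction_le hγ x t
  -- The extra `1` compensates for stopping the limit at a finite time `t`.
  obtain ⟨p, hp, hp'⟩ := hX.exists_dist_eq x (γ t) (t := s + 1) (by linarith) (by linarith)
  exact ⟨p, hp.le, by linarith [horofunction_le hγ p t]⟩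

lemma SameEndpoint.symm (h : SameEndpoint γ η) : SameEndpoint η γ := by
  obtain ⟨C, hC⟩ := h
  exact ⟨C, fun t => by rw [dist_comm]; exact hC t⟩

lemma SameEndpoint.trans {θ : ℝ≥0 → X} (h : SameEndpoint γ η) (h' : SameEndpoint η θ) :
    SameEndpoint γ θ := by
  obtain ⟨C, hC⟩ := h
  obtain ⟨D, hD⟩ := h'
  exact ⟨C + D, fun t => (dist_triangle _ (η t) _).trans (add_le_add (hC t) (hD t))⟩

lemma SameEndpoint.exists_horofunction_le (h : SameEndpoint γ η) (hγ : Isometry γ)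
    (hη : Isometry η) : ∃ C, ∀ x, horofunction η x ≤ horofunction γ x + C := by
  obtain ⟨C, hC⟩ := h
  refine ⟨C, fun x => ?_⟩
  refine le_of_tendsto_of_tendsto' (tendsto_horofunction hη x)
    ((tendsto_horofunction hγ x).add_const C) fun t => ?_
  linarith [dist_triangle x (γ t) (η t), hC t]

/-- A geodesic ray that remains in a horoball converges to the centre of the horoball. -/
lemma FourPoint.sameEndpoint {δ : ℝ} (hδ : FourPoint X δ) (hδ0 : 0 ≤ δ) (hγ : Isometry γ)
    (hη : Isometry η) {r : ℝ} (h : ∀ᶠ t in atTop, horofunction η (γ t) < r) :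
    SameEndpoint γ η := by
  set o := η 0 with ho
  set D := dist o (γ 0) with hD
  have hD0 : 0 ≤ D := dist_nonneg
  refine ⟨D + 4 * δ, fun u => ?_⟩
  have h2 : ∀ᶠ t : ℝ≥0 in atTop, 2 * (u : ℝ) + D + |r| ≤ t :=
    (NNReal.tendsto_coe_atTop.2 tendsto_id).eventually_ge_atTop _
  obtain ⟨t, ⟨ht, ht'⟩, htu⟩ := ((h.and h2).and (eventually_ge_atTop u)).exists
  obtain ⟨s, hs, hsu⟩ := (((tendsto_horofunction hη (γ t)).eventually_lt_const ht).and
    (eventually_ge_atTop u)).exists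
  have hr := le_abs_self r
  have e1 := dist_ray hγ htu
  have e2 := dist_ray hη hsu
  have e3 := dist_ray hη (zero_le (a := s))
  have e4 := dist_ray hη (zero_le (a := u))
  have e5 := dist_ray hγ (zero_le (a := t))
  have e6 := dist_ray hγ (zero_le (a := u))
  rw [NNReal.coe_zero, sub_zero] at e3 e4 e5 e6
  have h3 := hδ (γ u) (η s) o (γ t)
  have h4 := hδ (γ u) (η u) o (η s)
  have h5 := dist_triangle (γ 0) o (γ t)
  have h6 := dist_triangle o (γ 0) (γ u)
  rw [dist_comm (γ 0) o] at h5
  rw [dist_comm (γ u) o, dist_comm (η s) (γ t), dist_comm (η s) o] at h3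
  rw [dist_comm (γ u) o, dist_comm (η u) o] at h4
  -- The choice of `t` makes both terms of the maximum in `h3` satisfy this bound; then `h4`
  -- compares the two rays at time `u`.
  have h7 : dist (γ u) (η s) ≤ s - u + D + 2 * δ := by
    rcases max_cases (dist o (γ u) + dist (γ t) (η s)) (dist (γ u) (γ t) + dist o (η s))
      with h8 | h8 <;> linarith
  rcases max_cases (dist o (γ u) + dist (η u) (η s)) (dist (γ u) (η s) + dist o (η u))
    with h8 | h8 <;> linarith

end MetricGeometry

/-! ### The quotient distance and the coordinates in the wedge of rays. -/

section Quotient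

variable {G : Type*} [Group G] {X : Type*} [MetricSpace X] [MulAction G X]

lemma quotDist_le {p q : MulAction.orbitRel.Quotient G X} {x y : X} (hx : x ∈ p.orbit)
    (hy : y ∈ q.orbit) : quotDist p q ≤ dist x y := by
  refine ciInf_le (f := fun z : p.orbit × q.orbit => dist (z.1 : X) (z.2 : X))
    ⟨0, ?_⟩ (⟨x, hx⟩, ⟨y, hy⟩)
  rintro _ ⟨z, rfl⟩
  exact dist_nonneg

lemma exists_dist_smul_lt [IsIsometricSMul G X] {p q : MulAction.orbitRel.Quotient G X} {x y : X}
    (hx : x ∈ p.orbit) (hy : y ∈ q.orbit) {r : ℝ} (h : quotDist p q < r) :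
    ∃ g : G, dist x (g • y) < r := by
  have : Nonempty (p.orbit × q.orbit) := ⟨(⟨x, hx⟩, ⟨y, hy⟩)⟩
  obtain ⟨⟨⟨a, ha⟩, ⟨b, hb⟩⟩, hab⟩ := exists_lt_of_ciInf_lt h
  rw [MulAction.orbitRel.Quotient.mem_orbit] at hx hy ha hb
  obtain ⟨g, rfl⟩ : a ∈ MulAction.orbit G x := by
    rw [← MulAction.orbitRel_apply, ← Quotient.eq'', ha, hx]
  obtain ⟨g', rfl⟩ : b ∈ MulAction.orbit G y := by
    rw [← MulAction.orbitRel_apply, ← Quotient.eq'', hb, hy]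
  refine ⟨g⁻¹ * g', ?_⟩
  simp only at hab
  rwa [mul_smul, ← dist_smul g, smul_inv_smul]

end Quotient

section Wedge

variable {G : Type*} [Group G] {k : ℕ} {X : Type*} [MulAction G X]

/-- The `i`-th coordinate of the image of a point of `X` in the wedge of rays. -/
def wedgeCoord (f : MulAction.orbitRel.Quotient G X → RayWedge k) (x : X) (i : Fin k) : ℝ :=
  (f (Quotient.mk'' x)).1 i

variable {f : MulAction.orbitRel.Quotient G X → RayWedge k}

lemma wedgeCoord_smul (g : G) (x : X) : wedgeCoord f (g • x) = wedgeCoord f x := by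
  have : (Quotient.mk'' (g • x) : MulAction.orbitRel.Quotient G X) = Quotient.mk'' x :=
    MulAction.orbitRel.Quotient.quotient_smul_eq
  unfold wedgeCoord
  rw [this]

lemma wedgeCoord_nonneg (x : X) (i : Fin k) : 0 ≤ wedgeCoord f x i := (f _).2.1 i

lemma wedgeCoord_eq_zero {x : X} {i j : Fin k} (hi : 0 < wedgeCoord f x i) (hij : i ≠ j) :
    wedgeCoord f x j = 0 := by
  by_contra hj
  exact hij ((f _).2.2 i j hi.ne' hj)

end Wedge

/-! ### Rays and far points of the quotient lie in horoballs. -/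

section Gromov

variable {G : Type*} [Group G] {k : ℕ} {X : Type*} [MetricSpace X] [MulAction G X]
  {f : MulAction.orbitRel.Quotient G X → RayWedge k}

lemma exists_wedgeCoord_le [IsIsometricSMul G X]
    (hf : IsQuasiIsometry quotDist RayWedge.distance f) :
    ∃ E : ℝ, 0 ≤ E ∧ (∀ x y i, |wedgeCoord f x i - wedgeCoord f y i| ≤ E * dist x y + E) ∧
      ∀ x y, ∃ g : G, dist x (g • y) ≤ E * (1 + ∑ i, |wedgeCoord f x i - wedgeCoord f y i|) := by
  obtain ⟨L, C, hL, hC, hLC, -⟩ := hf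
  have hL0 : 0 < L := by linarith
  have hmem : ∀ x : X, x ∈ MulAction.orbitRel.Quotient.orbit
      (Quotient.mk'' x : MulAction.orbitRel.Quotient G X) :=
    fun x => MulAction.orbitRel.Quotient.mem_orbit.2 rfl
  refine ⟨L * C + L + C + 1, by positivity, fun x y i => ?_, fun x y => ?_⟩
  · have h1 := (hLC (Quotient.mk'' x) (Quotient.mk'' y)).2
    have h2 := quotDist_le (hmem x) (hmem y)
    have h3 : |wedgeCoord f x i - wedgeCoord f y i| ≤ ∑ j, |wedgeCoord f x j - wedgeCoord f y j| :=
      Finset.single_le_sum (f := fun j => |wedgeCoord f x j - wedgeCoord f y j|)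
        (fun j _ => abs_nonneg _) (Finset.mem_univ i)
    refine h3.trans (h1.trans ?_)
    have h4 : 0 ≤ dist x y := dist_nonneg
    have h5 := mul_le_mul_of_nonneg_left h2 hL0.le
    nlinarith [mul_nonneg hL0.le hC, mul_nonneg (mul_nonneg hL0.le hC) h4, mul_nonneg hC h4]
  · have h1 := (hLC (Quotient.mk'' x) (Quotient.mk'' y)).1
    set D := RayWedge.distance (f (Quotient.mk'' x)) (f (Quotient.mk'' y)) with hD
    have hD' : D = ∑ i, |wedgeCoord f x i - wedgeCoord f y i| := rfl
    have hD0 : 0 ≤ D := hD' ▸ Finset.sum_nonneg fun i _ => abs_nonneg _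
    have h2 : quotDist (Quotient.mk'' x : MulAction.orbitRel.Quotient G X) (Quotient.mk'' y) ≤
        L * (D + C) := by
      rw [← inv_mul_le_iff₀ hL0]
      linarith
    obtain ⟨g, hg⟩ := exists_dist_smul_lt (hmem x) (hmem y) (h2.trans_lt (lt_add_one _))
    refine ⟨g, hg.le.trans ?_⟩
    rw [← hD']
    nlinarith [mul_nonneg hL0.le hC, mul_nonneg (mul_nonneg hL0.le hC) hD0, mul_nonneg hC hD0]

lemma isometry_smul_ray [IsIsometricSMul G X] (g : G) {γ : ℝ≥0 → X} (hγ : Isometry γ) :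
    Isometry fun t => g • γ t :=
  (isometry_smul X g).comp hγ

lemma isOpen_of_isHoroball {B : Set X} (hB : IsHoroball B) : IsOpen B := by
  obtain ⟨γ, r, hγ, rfl⟩ := hB
  exact isOpen_lt (continuous_horofunction hγ) continuous_const

/-- Two geodesic rays that remain in the same horoball have the same endpoint. -/
lemma FourPoint.sameEndpoint_of_isHoroball {δ : ℝ} (hδ : FourPoint X δ) (hδ0 : 0 ≤ δ) {B : Set X}
    (hB : IsHoroball B) {γ γ' : ℝ≥0 → X} (hγ : Isometry γ) (hγ' : Isometry γ')
    (h : ∀ᶠ t in atTop, γ t ∈ B) (h' : ∀ᶠ t in atTop, γ' t ∈ B) : SameEndpoint γ γ' := by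
  obtain ⟨η, r, hη, rfl⟩ := hB
  exact (hδ.sameEndpoint hδ0 hγ hη h).trans (hδ.sameEndpoint hδ0 hγ' hη h').symm

/-- A geodesic ray whose image in the quotient goes to infinity is eventually in one of the
horoballs, and so are the points on which its horofunction is sufficiently negative. -/
lemma FourPoint.exists_horoball {δ : ℝ} (hδ : FourPoint X δ) (hδ0 : 0 ≤ δ) {𝓑 : Set (Set X)}
    (h𝓑 : ∀ B ∈ 𝓑, IsHoroball B) (hdisj : 𝓑.PairwiseDisjoint id) {γ : ℝ≥0 → X} (hγ : Isometry γ)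
    (hev : ∀ᶠ t in atTop, γ t ∈ ⋃₀ 𝓑) :
    ∃ B ∈ 𝓑, ∃ r : ℝ, ∀ x, horofunction γ x ≤ r → x ∈ B := by
  obtain ⟨T, hT⟩ := hev.exists_forall_of_atTop
  obtain ⟨B, hB, hTB⟩ := hT T le_rfl
  -- A connected tail of the ray covered by disjoint open horoballs stays in one of them.
  have hsub : γ '' Set.Ici T ⊆ B := by
    refine (isPreconnected_Ici.image γ hγ.continuous.continuousOn).subset_left_of_subset_union
      (isOpen_of_isHoroball (h𝓑 B hB))
      (isOpen_sUnion (s := 𝓑 \ {B}) fun B' hB' => isOpen_of_isHoroball (h𝓑 B' hB'.1)) ?_ ?_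
      ⟨γ T, ⟨T, Set.self_mem_Ici, rfl⟩, hTB⟩
    · refine Set.disjoint_sUnion_right.2 fun B' hB' => ?_
      exact hdisj hB hB'.1 fun h => hB'.2 h.symm
    · rintro _ ⟨t, ht, rfl⟩
      obtain ⟨B', hB', htB'⟩ := hT t ht
      by_cases h : B' = B
      · exact Or.inl (h ▸ htB')
      · exact Or.inr ⟨B', ⟨hB', h⟩, htB'⟩
  refine ⟨B, hB, ?_⟩
  obtain ⟨η, r, hη, rfl⟩ := h𝓑 B hB
  have hend : SameEndpoint γ η := hδ.sameEndpoint hδ0 hγ hη (r := r) (by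
    filter_upwards [eventually_ge_atTop T] with t ht
    exact hsub ⟨t, ht, rfl⟩)
  obtain ⟨C, hC⟩ := hend.exists_horofunction_le hγ hη
  refine ⟨r - C - 1, fun x hx => ?_⟩
  have := hC x
  change horofunction η x < r
  linarith

lemma horofunction_smul_le_of_sub [IsIsometricSMul G X] {γ : ℝ≥0 → X} (hγ : Isometry γ) {p : X}
    {g : G} {t : ℝ≥0} {E : ℝ} (h : dist p (g • γ t) ≤ E) :
    horofunction γ (g⁻¹ • p) ≤ E - t := by
  have h1 := horofunction_le hγ (g⁻¹ • p) t
  have h2 : dist (g⁻¹ • p) (γ t) = dist p (g • γ t) := by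
    rw [← dist_smul g, smul_inv_smul]
  linarith

/-- The points of the quotient that are far out lie deep in the horoballs. -/
lemma exists_horofunction_le_or_dist_le [IsIsometricSMul G X] {γ : Fin k → ℝ≥0 → X}
    (hf : IsQuasiIsometry quotDist RayWedge.distance f) (hγ : ∀ i, Isometry (γ i))
    (hγf : ∀ i, Tendsto (fun t => wedgeCoord f (γ i t) i) atTop atTop) (ρ : Fin k → ℝ) (x₀ : X) :
    ∃ R : ℝ, ∀ p, (∃ i, ∃ g : G, horofunction (γ i) (g⁻¹ • p) < ρ i) ∨
      ∃ g : G, dist p (g • x₀) ≤ R := by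
  classical
  obtain ⟨E, hE0, hE, hE'⟩ := exists_wedgeCoord_le hf
  set N : ℝ := ∑ i, |E * (1 + 2 * E) - ρ i| + 1 with hN
  have hN0 : 0 ≤ N := add_nonneg (Finset.sum_nonneg fun i _ => abs_nonneg _) zero_le_one
  have hNi : ∀ i, E * (1 + 2 * E) - ρ i < N := by
    intro i
    have h1 := Finset.single_le_sum (f := fun i => |E * (1 + 2 * E) - ρ i|)
      (fun i _ => abs_nonneg _) (Finset.mem_univ i)
    have h2 := le_abs_self (E * (1 + 2 * E) - ρ i)
    linarith
  set T : ℝ := ∑ i, wedgeCoord f (γ i 0) i + E * N + E with hT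
  have hT0 : 0 ≤ T := by
    have : 0 ≤ ∑ i, wedgeCoord f (γ i 0) i := Finset.sum_nonneg fun i _ => wedgeCoord_nonneg _ _
    positivity
  have hTi : ∀ i, wedgeCoord f (γ i 0) i + E * N + E ≤ T := by
    intro i
    have h1 := Finset.single_le_sum (f := fun i => wedgeCoord f (γ i 0) i)
      (fun i _ => wedgeCoord_nonneg _ _) (Finset.mem_univ i)
    linarith
  refine ⟨E * (1 + ∑ i, (T + |wedgeCoord f x₀ i|)), fun p => ?_⟩
  by_cases hp : ∀ i, wedgeCoord f p i ≤ T
  · right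
    obtain ⟨g, hg⟩ := hE' p x₀
    refine ⟨g, hg.trans ?_⟩
    gcongr with i
    refine (abs_sub _ _).trans ?_
    gcongr
    rw [abs_of_nonneg (wedgeCoord_nonneg _ _)]
    exact hp i
  · left
    push Not at hp
    obtain ⟨i, hi⟩ := hp
    -- The least such `n` gives a point of the ray with nearly the coordinates of `p`, so a
    -- translate of it is near `p`. Since the coordinate of `p` exceeds `T`, the time `n` exceeds
    -- `N`, which makes the translated horofunction small at `p`.
    have hex : ∃ n : ℕ, wedgeCoord f p i ≤ wedgeCoord f (γ i n) i := by
      have h1 : Tendsto (fun n : ℕ => (n : ℝ≥0)) atTop atTop := tendsto_natCast_atTop_atTop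
      exact (((hγf i).comp h1).eventually_ge_atTop _).exists
    have hspec := Nat.find_spec hex
    set n := Nat.find hex with hn
    have hray : ∀ s t : ℝ≥0, |wedgeCoord f (γ i s) i - wedgeCoord f (γ i t) i| ≤
        E * |(s : ℝ) - t| + E := by
      intro s t
      have := hE (γ i s) (γ i t) i
      rwa [(hγ i).dist_eq, NNReal.dist_eq] at this
    have hnN : N < n := by
      by_contra! hcon
      have h1 := hray n 0
      have h2 := le_abs_self (wedgeCoord f (γ i n) i - wedgeCoord f (γ i 0) i)
      rw [NNReal.coe_natCast, NNReal.coe_zero, sub_zero, Nat.abs_cast] at h1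
      have h3 := hTi i
      have h4 := mul_le_mul_of_nonneg_left hcon hE0
      linarith
    have hn0 : n ≠ 0 := by
      rintro h0
      rw [h0, Nat.cast_zero] at hnN
      linarith
    obtain ⟨n', hn'⟩ := Nat.exists_eq_succ_of_ne_zero hn0
    have hmin := Nat.find_min hex (m := n') (by omega)
    push Not at hmin
    have hclose : wedgeCoord f (γ i n) i ≤ wedgeCoord f p i + 2 * E := by
      have h1 := hray n n'
      have h2 := le_abs_self (wedgeCoord f (γ i n) i - wedgeCoord f (γ i n') i)
      have h3 : ((n : ℝ≥0) : ℝ) - ((n' : ℝ≥0) : ℝ) = 1 := by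
        rw [hn']
        push_cast
        ring
      rw [h3, abs_one] at h1
      linarith
    obtain ⟨g, hg⟩ := hE' p (γ i n)
    have hsum : ∑ j, |wedgeCoord f p j - wedgeCoord f (γ i n) j| ≤ 2 * E := by
      rw [Finset.sum_eq_single i]
      · rw [abs_le]
        constructor <;> linarith
      · intro j _ hji
        rw [wedgeCoord_eq_zero (by linarith : 0 < wedgeCoord f p i) hji.symm,
          wedgeCoord_eq_zero (by linarith : 0 < wedgeCoord f (γ i n) i) hji.symm,
            sub_zero, abs_zero]
      · simp
    refine ⟨i, g, ?_⟩
    have h1 := horofunction_smul_le_of_sub (hγ i)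
      (hg.trans (mul_le_mul_of_nonneg_left (add_le_add_right hsum 1) hE0))
    have h2 := hNi i
    rw [NNReal.coe_natCast] at h1
    linarith

end Gromov

/-! ### Construction of a horoball system from a Gromov action. -/

section Finiteness

variable {G : Type*} [Group G] {k : ℕ} {H : Fin k → Subgroup G} {X : Type*} [MetricSpace X]

/-- Only finitely many of a family of disjoint horoballs meet a given ball. -/
lemma finite_cone_of_disjoint [ProperSpace X] {h : Cone H → X → ℝ}
    (hlip : ∀ c x y, h c x ≤ h c y + dist x y)
    (hdesc : ∀ c x s, 0 ≤ s → ∃ p, dist x p ≤ s + 1 ∧ h c p ≤ h c x - s)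
    (hdisj : ∀ c c' x, h c x ≤ 0 → h c' x ≤ 0 → c = c') (x₀ : X) (r : ℝ) :
    {c | h c x₀ ≤ r}.Finite := by
  -- For the cosets counted, `p c` has level at most `-1`, so a coset whose point is within `1` of
  -- it has the same horoball. The points lie in a compact ball, covered by finitely many balls of
  -- radius `1 / 2`.
  choose! p hp hp' using fun c => hdesc c x₀ (|r| + 1) (by positivity)
  obtain ⟨t, -, ht, htc⟩ := IsCompact.finite_cover_balls
    (isCompact_closedBall x₀ (|r| + 1 + 1)) one_half_pos
  have hmem : ∀ c, ∃ z ∈ t, dist (p c) z < 1 / 2 := by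
    intro c
    have h1 : p c ∈ Metric.closedBall x₀ (|r| + 1 + 1) := by
      rw [Metric.mem_closedBall, dist_comm]
      exact hp c
    obtain ⟨z, hz, hpz⟩ := Set.mem_iUnion₂.1 (htc h1)
    exact ⟨z, hz, hpz⟩
  choose z hz hpz using hmem
  refine Set.Finite.of_finite_image (f := z) (ht.subset ?_) ?_
  · rintro _ ⟨c, -, rfl⟩
    exact hz c
  · intro c hc c' hc' hcc
    simp only [Set.mem_ofPred_eq] at hc hc'
    have h1 := hpz c
    have h2 := hpz c'
    rw [hcc] at h1
    have h3 := dist_triangle_right (p c') (p c) (z c')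
    have h4 := hlip c (p c') (p c)
    have h5 := hp' c
    have h6 := hp' c'
    have h7 := le_abs_self r
    exact hdisj c c' (p c') (by linarith) (by linarith)

end Finiteness

section Gromov

variable {G : Type*} [Group G] {k : ℕ} {H : Fin k → Subgroup G} {X : Type*} [MetricSpace X]
  [MulAction G X]

/-- The horofunction of the parabolic point that corresponds to a coset, shifted by `ρ`. -/
noncomputable def cosetHorofunction (H : Fin k → Subgroup G) (γ : Fin k → ℝ≥0 → X)
    (ρ : Fin k → ℝ) (c : Cone H) (x : X) : ℝ :=
  horofunction (γ c.1) ((Quotient.out c.2 : G)⁻¹ • x) - ρ c.1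

/-- The choice of representative is immaterial because `H i` preserves the horofunction of `γ i`. -/
lemma cosetHorofunction_mk {γ : Fin k → ℝ≥0 → X}
    (hH : ∀ i, ∀ g ∈ H i, ∀ x, horofunction (γ i) (g • x) = horofunction (γ i) x) (ρ : Fin k → ℝ)
    (i : Fin k) (g : G) (x : X) :
    cosetHorofunction H γ ρ ⟨i, g⟩ x = horofunction (γ i) (g⁻¹ • x) - ρ i := by
  have hmem : (Quotient.out (g : G ⧸ H i) : G)⁻¹ * g ∈ H i :=
    QuotientGroup.eq.1 (QuotientGroup.out_eq' _)
  have := hH i _ hmem (g⁻¹ • x)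
  rw [mul_smul, smul_inv_smul] at this
  rw [cosetHorofunction, this]

theorem IsGromovAction.exists_horoballSystem (S : IsGromovAction H X) :
    ∃ (δ R : ℝ) (x₀ : X) (h : Cone H → X → ℝ), HoroballSystem H δ R x₀ h := by
  classical
  have := S.complete
  have := S.locallyCompact
  have := S.isometric
  have := S.properlyDiscontinuous
  have hgeo := S.geodesic
  have hproper := hgeo.properSpace
  obtain ⟨δ, hδ0, hδ⟩ : ∃ δ, 0 ≤ δ ∧ FourPoint X δ := S.hyperbolic
  obtain ⟨f, γ, hf, hrays⟩ := S.rays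
  have hγ := fun i => (hrays i).1
  have hγf : ∀ i, Tendsto (fun t => wedgeCoord f (γ i t) i) atTop atTop := fun i => (hrays i).2.1
  have hγH := fun i => (hrays i).2.2.1
  have hinv := fun i => (hrays i).2.2.2
  obtain ⟨𝓑, h𝓑, h𝓑inv, h𝓑disj, K, hK, -, hKcov⟩ := S.horoballs
  obtain ⟨E, hE0, hE, -⟩ := exists_wedgeCoord_le hf
  have hX : Nonempty X := by
    obtain ⟨_, _, _, _, _, hsurj⟩ := hf
    obtain ⟨p, -⟩ := hsurj ⟨fun _ => 0, fun _ => le_rfl, fun _ _ h => absurd rfl h⟩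
    exact ⟨p.out⟩
  obtain ⟨x₀⟩ := hX
  -- Wedge coordinates are bounded on the complement of the horoballs, by cocompactness, but tend to
  -- infinity along the ray.
  have hev : ∀ i, ∀ᶠ t in atTop, γ i t ∈ ⋃₀ 𝓑 := by
    intro i
    obtain ⟨r, hr⟩ := hK.isBounded.subset_closedBall x₀
    filter_upwards [(hγf i).eventually_gt_atTop (wedgeCoord f x₀ i + (E * r + E))] with t ht
    by_contra hcon
    obtain ⟨g, y, hy, hyt⟩ := Set.mem_iUnion.1 (hKcov hcon)
    have h1 : wedgeCoord f (γ i t) i = wedgeCoord f y i := by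
      rw [← hyt]
      exact congrFun (wedgeCoord_smul g y) i
    have h2 := (le_abs_self _).trans (hE y x₀ i)
    have h3 := mul_le_mul_of_nonneg_left (Metric.mem_closedBall.1 (hr hy)) hE0
    linarith
  choose B hB ρ hρ using fun i => hδ.exists_horoball hδ0 h𝓑 h𝓑disj (hγ i) (hev i)
  have hBev : ∀ i, ∀ᶠ t in atTop, γ i t ∈ B i := by
    intro i
    have h2 : ∀ᶠ t : ℝ≥0 in atTop, -ρ i ≤ t :=
      (NNReal.tendsto_coe_atTop.2 tendsto_id).eventually_ge_atTop _
    filter_upwards [h2] with t ht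
    exact hρ i _ ((horofunction_ray_le (hγ i) t).trans (by linarith))
  set h := cosetHorofunction H γ ρ with hh
  have hmk : ∀ i (g : G) x, h ⟨i, g⟩ x = horofunction (γ i) (g⁻¹ • x) - ρ i :=
    cosetHorofunction_mk hinv ρ
  have hequiv : ∀ (g : G) (c : Cone H) x, h ⟨c.1, g • c.2⟩ (g • x) = h c x := by
    rintro g ⟨i, q⟩ x
    obtain ⟨a, rfl⟩ := QuotientGroup.mk_surjective q
    have h1 : g • (a : G ⧸ H i) = ((g * a : G) : G ⧸ H i) := rfl
    dsimp only
    rw [h1, hmk, hmk, mul_inv_rev, mul_smul, inv_smul_smul]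
  have hlip : ∀ c x y, h c x ≤ h c y + dist x y := by
    intro c x y
    have := horofunction_le_add_dist (hγ c.1) ((Quotient.out c.2 : G)⁻¹ • x)
      ((Quotient.out c.2 : G)⁻¹ • y)
    rw [dist_smul] at this
    simp only [hh, cosetHorofunction]
    linarith
  have hdesc : ∀ c x s, 0 ≤ s → ∃ p, dist x p ≤ s + 1 ∧ h c p ≤ h c x - s := by
    intro c x s hs
    obtain ⟨p, hp, hp'⟩ := hgeo.exists_horofunction_le (hγ c.1) ((Quotient.out c.2 : G)⁻¹ • x) hs
    refine ⟨(Quotient.out c.2 : G) • p, ?_, ?_⟩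
    · rwa [← dist_smul (Quotient.out c.2 : G)⁻¹, inv_smul_smul]
    · simp only [hh, cosetHorofunction, inv_smul_smul]
      linarith
  have hdisj : ∀ c c' x, h c x ≤ 0 → h c' x ≤ 0 → c = c' := by
    rintro ⟨i, q⟩ ⟨j, q'⟩ x h1 h2
    obtain ⟨g, rfl⟩ := QuotientGroup.mk_surjective q
    obtain ⟨g', rfl⟩ := QuotientGroup.mk_surjective q'
    change h ⟨i, (g : G ⧸ H i)⟩ x ≤ 0 at h1
    change h ⟨j, (g' : G ⧸ H j)⟩ x ≤ 0 at h2
    rw [hmk] at h1 h2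
    -- The two translated horoballs meet at `x`, so they coincide, and the translated rays share an
    -- endpoint. Wedge coordinates then force `i = j`, and the isotropy condition puts `g'⁻¹ * g` in
    -- `H i`.
    have h3 : (fun x => g • x) '' B i = (fun x => g' • x) '' B j := by
      refine h𝓑disj.elim (h𝓑inv g _ (hB i)) (h𝓑inv g' _ (hB j)) ?_
      refine Set.not_disjoint_iff.2 ⟨x, ⟨g⁻¹ • x, hρ i _ (by linarith), smul_inv_smul _ _⟩,
        ⟨g'⁻¹ • x, hρ j _ (by linarith), smul_inv_smul _ _⟩⟩
    have hend : SameEndpoint (fun t => g • γ i t) (fun t => g' • γ j t) := by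
      refine hδ.sameEndpoint_of_isHoroball hδ0 (h𝓑 _ (h𝓑inv g _ (hB i)))
        (isometry_smul_ray g (hγ i)) (isometry_smul_ray g' (hγ j)) ?_ ?_
      · filter_upwards [hBev i] with t ht
        exact ⟨_, ht, rfl⟩
      · filter_upwards [hBev j] with t ht
        rw [h3]
        exact ⟨_, ht, rfl⟩
    obtain ⟨C, hC⟩ := hend
    obtain rfl : i = j := by
      by_contra hij
      obtain ⟨t, ht, ht'⟩ := (((hγf i).eventually_gt_atTop (E * C + E)).and
        ((hγf j).eventually_gt_atTop 0)).exists
      have h4 := (le_abs_self _).trans (hE (g • γ i t) (g' • γ j t) i)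
      rw [wedgeCoord_smul, wedgeCoord_smul, wedgeCoord_eq_zero ht' (Ne.symm hij)] at h4
      have h5 := mul_le_mul_of_nonneg_left (hC t) hE0
      linarith
    have h4 : g'⁻¹ * g ∈ H i := by
      refine (hγH i _).2 ⟨C, fun t => ?_⟩
      have h5 := hC t
      rwa [← dist_smul g'⁻¹, inv_smul_smul, smul_smul] at h5
    have h5 : (g' : G ⧸ H i) = g := QuotientGroup.eq.2 h4
    rw [Sigma.mk.injEq]
    exact ⟨rfl, heq_of_eq h5.symm⟩
  obtain ⟨R₁, hR₁⟩ := exists_horofunction_le_or_dist_le hf hγ hγf ρ x₀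
  -- By disjointness at most one of the functions is negative at `x₀`.
  obtain ⟨R₂, hR₂0, hR₂⟩ : ∃ R₂, 0 ≤ R₂ ∧ ∀ c, -R₂ ≤ h c x₀ := by
    by_cases hall : ∀ c, 0 ≤ h c x₀
    · exact ⟨0, le_rfl, fun c => by simpa using hall c⟩
    · push Not at hall
      obtain ⟨c, hc⟩ := hall
      refine ⟨-h c x₀, by linarith, fun c' => ?_⟩
      rw [neg_neg]
      by_cases hc' : c = c'
      · rw [hc']
      · by_contra! hlt
        exact hc' (hdisj c c' x₀ hc.le (hlt.trans hc).le)
  obtain ⟨R₃, hR₃⟩ : ∃ R₃, ∀ i, horofunction (γ i) x₀ - ρ i ≤ R₃ :=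
    (Finite.exists_le fun i => horofunction (γ i) x₀ - ρ i)
  refine ⟨δ, max R₁ (max R₂ R₃), x₀, h, ?_⟩
  refine
    { geodesic := hgeo
      isometric := inferInstance
      fourPoint := hδ
      nonneg_δ := hδ0
      nonneg_R := hR₂0.trans (le_max_of_le_right (le_max_left _ _))
      fourPoint_horo := fun c x y z => ?_
      lipschitz := hlip
      descend := hdesc
      disjoint := hdisj
      cobounded := fun p => ?_
      upper := ?_
      lower := fun c g => ?_
      finite_orbit := fun r => ?_
      finite_cone := finite_cone_of_disjoint hlip hdesc hdisj x₀
      equivariant := hequiv }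
  · have h1 := hδ.add_horofunction_le (hγ c.1) ((Quotient.out c.2 : G)⁻¹ • x)
      ((Quotient.out c.2 : G)⁻¹ • y) ((Quotient.out c.2 : G)⁻¹ • z)
    simp only [dist_smul] at h1
    simp only [hh, cosetHorofunction]
    rw [← add_sub_assoc, sub_add_eq_add_sub, ← add_sub_assoc, max_sub_sub_right]
    linarith
  · rcases hR₁ p with ⟨i, g, hg⟩ | ⟨g, hg⟩
    · refine Or.inl ⟨⟨i, g⟩, ?_⟩
      rw [hmk]
      linarith
    · exact Or.inr ⟨g, hg.trans (le_max_left _ _)⟩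
  · rintro ⟨i, q⟩ g hg
    obtain rfl : (g : G ⧸ H i) = q := hg
    rw [hmk, inv_smul_smul]
    exact (hR₃ i).trans (le_max_of_le_right (le_max_right _ _))
  · have h1 := hequiv g⁻¹ c (g • x₀)
    rw [inv_smul_smul] at h1
    rw [← h1]
    refine le_trans (neg_le_neg ?_) (hR₂ _)
    exact le_max_of_le_right (le_max_left _ _)
  · refine (ProperlyDiscontinuousSMul.finite_disjoint_inter_image (Γ := G)
      (isCompact_singleton (x := x₀)) (isCompact_closedBall x₀ r)).subset fun g hg => ?_
    refine ⟨g • x₀, ⟨x₀, rfl, rfl⟩, ?_⟩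
    rw [Metric.mem_closedBall, dist_comm]
    exact hg

end Gromov

end RelHyp

theorem theoremt {G : Type u} [Group G] (hG : Group.FG G) {k : ℕ}
    (H : Fin k → Subgroup G) (hH : ∀ i, (H i).FG)
    (h : RelHyp.HyperbolicRelGromov.{u, v} H) :
    RelHyp.HyperbolicRelFarb H := by
  obtain ⟨X, _, _, hX⟩ := h
  obtain ⟨δ, R, x₀, h, S⟩ := hX.exists_horoballSystem
  intro A hAfin hA
  obtain ⟨R', hR'⟩ := (hAfin.image fun a => dist x₀ (a • x₀)).bddAbove
  have hAR : ∀ a ∈ A, dist x₀ (a • x₀) ≤ max R R' :=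
    fun a ha => le_max_of_le_right (hR' ⟨a, ha, rfl⟩)
  have S' := S.mono (le_max_left R R')
  exact ⟨S'.gromovHyperbolic_conedDist hA hAR, S'.boundedCosetPenetration hA hAR⟩
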